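/- Let $\mathcal S^6$ be the space of real symmetric $6\times 6$ matrices. A matrix $A\in\mathcal S^6$ is copositive if $x^TAx\ge 0$ for all entrywise nonnegative $x\in\mathbb R^6$; a copositive matrix is exceptional if it is not the sum of a positive semi-definite matrix and an entrywise nonnegative symmetric matrix, and extremal if it generates an extreme ray of the copositive cone. A zero of $A$ is a non-zero entrywise nonnegative vector $u$ with $u^TAu=0$; its support is the index set of its positive entries; it is minimal if no zero of $A$ has strictly smaller support. The minimal zero support set of $A$ is the set of supports of its minimal zeros. Let $\mathcal G_6$ be the group of linear transformations of $\mathcal S^6$ generated by simultaneous permutations of the row and column indices and the maps $A\mapsto DAD$ with $D$ a positive definite diagonal matrix. For $j=1,\dots,6$ let $I_j=\{j,j+1,j+2,j+3\}$ with indices taken modulo 6 in $\{1,\dots,6\}$. For $\varphi_1,\varphi_2,\varphi_3\in\mathbb R$ put $\sigma=\varphi_1+\varphi_2+\varphi_3$ and $$T=\begin{pmatrix} 1&-\cos\varphi_1&\cos(\varphi_1+\varphi_2)&-\cos\sigma&\cos(\varphi_2+\varphi_3)&-\cos\varphi_3\\ -\cos\varphi_1&1&-\cos\varphi_2&\cos(\varphi_2+\varphi_3)&-\cos\sigma&\cos(\varphi_1+\varphi_3)\\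 \cos(\varphi_1+\varphi_2)&-\cos\varphi_2&1&-\cos\varphi_3&\cos(\varphi_1+\varphi_3)&-\cos\sigma\\ -\cos\sigma&\cos(\varphi_2+\varphi_3)&-\cos\varphi_3&1&-\cos\varphi_1&\cos(\varphi_1+\varphi_2)\\ \cos(\varphi_2+\varphi_3)&-\cos\sigma&\cos(\varphi_1+\varphi_3)&-\cos\varphi_1&1&-\cos\varphi_2\\ -\cos\varphi_3&\cos(\varphi_1+\varphi_3)&-\cos\sigma&\cos(\varphi_1+\varphi_2)&-\cos\varphi_2&1 \end{pmatrix},$$ $$V=\begin{pmatrix} \sin\varphi_2&0&0&0&\sin\varphi_2&\sin(\varphi_1+\varphi_3)\\ \sin(\varphi_1+\varphi_2)&\sin\varphi_3&0&0&0&\sin\varphi_3\\ \sin\varphi_1&\sin(\varphi_2+\varphi_3)&\sin\varphi_1&0&0&0\\ 0&\sin\varphi_2&\sin(\varphi_1+\varphi_3)&\sin\varphi_2&0&0\\ 0&0&\sin\varphi_3&\sin(\varphi_1+\varphi_2)&\sin\varphi_3&0\\ 0&0&0&\sin\varphi_1&\sin(\varphi_2+\varphi_3)&\sin\varphi_1 \end{pmatrix}.$$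 Let $A$ be an exceptional extremal copositive $6\times 6$ matrix having zeros $u^1,\dots,u^6$ whose supports are $I_1,\dots,I_6$, respectively. Then $A$ lies in the $\mathcal G_6$-orbit of the matrix $T$ for some $\varphi_1,\varphi_2,\varphi_3>0$ with $\varphi_1+\varphi_2+\varphi_3<\pi$, and the minimal zero support set of $A$ is $\{\{1,2,3\},\{2,3,4\},\{3,4,5\},\{4,5,6\},\{1,5,6\},\{1,2,6\}\}$. Conversely, for all $\varphi_1,\varphi_2,\varphi_3>0$ with $\varphi_1+\varphi_2+\varphi_3<\pi$, the matrix $T$ is copositive, exceptional and extremal, and its minimal zeros are exactly the positive multiples of the columns of $V$. -/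

import Mathlib

open Matrix

/-- The cone `C^n` of copositive matrices: real symmetric matrices `A` with `xᵀ A x ≥ 0` for all
entrywise nonnegative vectors `x`. -/
def Copositive {n : ℕ} (A : Matrix (Fin n) (Fin n) ℝ) : Prop :=
  A.IsSymm ∧ ∀ x : Fin n → ℝ, 0 ≤ x → 0 ≤ x ⬝ᵥ (A *ᵥ x)

/-- A copositive matrix is exceptional if it is not the sum of a positive semi-definite matrix and
an entrywise nonnegative symmetric matrix. -/
def IsExceptional {n : ℕ} (A : Matrix (Fin n) (Fin n) ℝ) : Prop :=
  Copositive A ∧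
    ¬ ∃ P N : Matrix (Fin n) (Fin n) ℝ,
      P.PosSemidef ∧ N.IsSymm ∧ (∀ i j, 0 ≤ N i j) ∧ A = P + N

/-- A copositive matrix is extremal if it generates an extreme ray of the copositive cone: it is
non-zero, and in every decomposition `A = B + C` into copositive matrices both summands are
nonnegative multiples of `A`. -/
def IsExtremalCopositive {n : ℕ} (A : Matrix (Fin n) (Fin n) ℝ) : Prop :=
  Copositive A ∧ A ≠ 0 ∧
    ∀ B C : Matrix (Fin n) (Fin n) ℝ, Copositive B → Copositive C → A = B + C →
      (∃ b : ℝ, 0 ≤ b ∧ B = b • A) ∧ (∃ c : ℝ, 0 ≤ c ∧ C = c • A)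

/-- A zero of `A`: a non-zero entrywise nonnegative vector `u` with `uᵀ A u = 0`. -/
def IsCopositiveZero {n : ℕ} (A : Matrix (Fin n) (Fin n) ℝ) (u : Fin n → ℝ) : Prop :=
  0 ≤ u ∧ u ≠ 0 ∧ u ⬝ᵥ (A *ᵥ u) = 0

/-- The support of a nonnegative vector: the index set of its positive elements. -/
def posSupport {n : ℕ} (u : Fin n → ℝ) : Set (Fin n) :=
  {i | 0 < u i}

/-- A zero is minimal if no zero has a strictly smaller support. -/
def IsMinimalZero {n : ℕ} (A : Matrix (Fin n) (Fin n) ℝ) (u : Fin n → ℝ) : Prop :=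
  IsCopositiveZero A u ∧ ∀ v, IsCopositiveZero A v → ¬ posSupport v ⊂ posSupport u

/-- The minimal zero support set: the set of supports of the minimal zeros. -/
def minimalZeroSupportSet {n : ℕ} (A : Matrix (Fin n) (Fin n) ℝ) : Set (Set (Fin n)) :=
  {S | ∃ u, IsMinimalZero A u ∧ posSupport u = S}

/-- The group `G_n` generated by the simultaneous permutations of the row and column indices and
the simultaneous pre- and post-multiplications with a positive definite diagonal matrix. It is
written as a group of linear automorphisms of the space of all square matrices, each of which
preserves the subspace of symmetric matrices. -/
def copositiveGroup (n : ℕ) :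
    Subgroup (Matrix (Fin n) (Fin n) ℝ ≃ₗ[ℝ] Matrix (Fin n) (Fin n) ℝ) :=
  Subgroup.closure
    ({g | ∃ σ : Equiv.Perm (Fin n), ∀ A, g A = A.submatrix σ σ} ∪
      {g | ∃ d : Fin n → ℝ, (∀ i, 0 < d i) ∧ ∀ A, g A = diagonal d * A * diagonal d})

/-- The four cyclically consecutive indices starting at `j` (indices are `0, …, 5` and addition is
modulo `6`). -/
def cyclicFour (j : Fin 6) : Set (Fin 6) :=
  {j, j + 1, j + 2, j + 3}

/-- The matrix with angles `a`, `b`, `c` (that is, `φ₁`, `φ₂`, `φ₃`). -/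
noncomputable def trigMatrix (a b c : ℝ) : Matrix (Fin 6) (Fin 6) ℝ :=
  !![1, -Real.cos a, Real.cos (a + b), -Real.cos (a + b + c), Real.cos (b + c), -Real.cos c;
    -Real.cos a, 1, -Real.cos b, Real.cos (b + c), -Real.cos (a + b + c), Real.cos (a + c);
    Real.cos (a + b), -Real.cos b, 1, -Real.cos c, Real.cos (a + c), -Real.cos (a + b + c);
    -Real.cos (a + b + c), Real.cos (b + c), -Real.cos c, 1, -Real.cos a, Real.cos (a + b);
    Real.cos (b + c), -Real.cos (a + b + c), Real.cos (a + c), -Real.cos a, 1, -Real.cos b;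
    -Real.cos c, Real.cos (a + c), -Real.cos (a + b + c), Real.cos (a + b), -Real.cos b, 1]

/-- The matrix whose columns are the minimal zeros, with angles `a`, `b`, `c` (that is, `φ₁`, `φ₂`,
`φ₃`). -/
noncomputable def trigZeroMatrix (a b c : ℝ) : Matrix (Fin 6) (Fin 6) ℝ :=
  !![Real.sin b, 0, 0, 0, Real.sin b, Real.sin (a + c);
    Real.sin (a + b), Real.sin c, 0, 0, 0, Real.sin c;
    Real.sin a, Real.sin (b + c), Real.sin a, 0, 0, 0;
    0, Real.sin b, Real.sin (a + c), Real.sin b, 0, 0;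
    0, 0, Real.sin c, Real.sin (a + b), Real.sin c, 0;
    0, 0, 0, Real.sin a, Real.sin (b + c), Real.sin a]

/-! At a zero of a copositive form, `A *ᵥ u` is nonnegative and vanishes on the support of `u`. For
zeros on the six cyclic windows of four indices these conditions almost characterise copositivity.
Subtracting a multiple of `u j` from a vector clears an entry at a controlled cost, so
semi-definiteness on the window `{0, 1, 2}` alone spreads round the cycle and gives copositivity
(`CyclicZeros.copositive`). Subtracting `ε x xᵀ` with `x` orthogonal to all `u j` preserves the
conditions. Hence, for an extremal exceptional `A`, no such non-zero `x` is dominated by the form on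
that window (`CyclicZeros.eq_zero_of_dominated`).

A vector orthogonal to all `u j` is a 6-periodic solution of the third-order recurrence with
coefficients `u j`. The monodromy over one period preserves the window form `P` and has positive
determinant. If `P` were nonsingular, the monodromy would be orientation preserving in the odd
dimension three and would have a fixed vector, which is excluded. So `P` is singular. After scaling
the diagonal to 1, `P` is the Gram matrix of three plane unit vectors, and the recurrence extends
them to a sequence `g` in the plane with `g (n + 6) = ω * g n`, `ω ≠ 1`
(`CyclicZeros.exists_unit_sequence`). Symmetry of the entries at distance three gives `g (n + 3) = ±
ρ * g n` with `ρ ^ 2 = ω`. The inequalities at distance four force the sign to be constant, so the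
angles between neighbours have period three: they are the three angles of `trigMatrix`
(`exists_angles`).

For the converse, each column of `V` annihilates all rows of `T` but one. Sums of neighbouring
columns satisfy the conditions above, which yields copositivity. For extremality, a copositive
summand `B` of `T` inherits these linear equations; they fix each row of `B` up to its diagonal
entry, and definiteness of `T` on neighbouring pairs makes the diagonal constant
(`IsCyclicTriple.eq_smul_of_add`). Minimal zeros are found by expanding a zero in three consecutive
columns. -/

lemma sum_fin_six_shift (k : Fin 6) (f : Fin 6 → ℝ) :
    ∑ i, f i = f k + f (k + 1) + f (k + 2) + f (k + 3) + f (k + 4) + f (k + 5) := by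
  have h : ∑ i, f i = ∑ i, f (k + i) :=
    (Equiv.sum_comp (Equiv.addLeft k) f).symm
  rw [h, Fin.sum_univ_six, add_zero]

lemma forall_fin_six_shift (k : Fin 6) {p : Fin 6 → Prop} (h0 : p k) (h1 : p (k + 1))
    (h2 : p (k + 2)) (h3 : p (k + 3)) (h4 : p (k + 4)) (h5 : p (k + 5)) (i : Fin 6) : p i := by
  obtain ⟨j, rfl⟩ : ∃ j, i = k + j := ⟨i - k, by abel⟩
  fin_cases j
  · simpa using h0
  · exact h1
  · exact h2
  · exact h3
  · exact h4
  · exact h5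

lemma fin_six_add_add (k : Fin 6) (a b c : Fin 6) (h : a + b = c) : k + a + b = k + c := by
  rw [add_assoc, h]

/-! ### First- and second-order conditions at a zero of a copositive form -/

section QuadraticForm

variable {n : ℕ} {A : Matrix (Fin n) (Fin n) ℝ}

lemma Matrix.IsSymm.dotProduct_mulVec_comm (hA : A.IsSymm) (x y : Fin n → ℝ) :
    x ⬝ᵥ (A *ᵥ y) = y ⬝ᵥ (A *ᵥ x) := by
  rw [dotProduct_mulVec, ← mulVec_transpose, hA.eq, dotProduct_comm]

lemma Matrix.IsSymm.quadratic_add_smul (hA : A.IsSymm) (x y : Fin n → ℝ) (c : ℝ) :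
    (x + c • y) ⬝ᵥ (A *ᵥ (x + c • y)) =
      x ⬝ᵥ (A *ᵥ x) + 2 * c * (x ⬝ᵥ (A *ᵥ y)) + c ^ 2 * (y ⬝ᵥ (A *ᵥ y)) := by
  have h := hA.dotProduct_mulVec_comm y x
  simp only [mulVec_add, mulVec_smul, add_dotProduct, dotProduct_add, smul_dotProduct,
    dotProduct_smul, smul_eq_mul, h]
  ring

lemma nonneg_of_forall_pos_quadratic {a b : ℝ} (h : ∀ t : ℝ, 0 < t → 0 ≤ 2 * t * b + t ^ 2 * a) :
    0 ≤ b := by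
  by_contra! hb
  have ha : 0 < |a| + 1 := by positivity
  -- The expression is `t * (2 * b + t * a)`; at this `t` the term `t * a` is less than `-b`, so the
  -- value is negative.
  have h1 := h (-b / (|a| + 1)) (by apply div_pos <;> linarith)
  set t := -b / (|a| + 1) with ht
  have htp : 0 < t := by apply div_pos <;> linarith
  have h2 : t * (|a| + 1) = -b := by rw [ht]; field_simp
  have h3 : t * a ≤ t * |a| := by gcongr; exact le_abs_self a
  nlinarith

lemma IsCopositiveZero.mulVec_nonneg (hA : Copositive A) {u : Fin n → ℝ}
    (hu : IsCopositiveZero A u) : 0 ≤ A *ᵥ u := by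
  intro i
  apply nonneg_of_forall_pos_quadratic (a := Pi.single i 1 ⬝ᵥ (A *ᵥ Pi.single i 1))
  intro t ht
  have h := hA.2 (u + t • Pi.single i 1)
    (add_nonneg hu.1 (smul_nonneg ht.le (Pi.single_nonneg.2 zero_le_one)))
  rw [hA.1.quadratic_add_smul, hu.2.2, hA.1.dotProduct_mulVec_comm u, single_one_dotProduct] at h
  linarith

lemma IsCopositiveZero.mulVec_eq_zero (hA : Copositive A) {u : Fin n → ℝ}
    (hu : IsCopositiveZero A u) {i : Fin n} (hi : 0 < u i) : (A *ᵥ u) i = 0 := by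
  have h : ∀ j ∈ Finset.univ, 0 ≤ u j * (A *ᵥ u) j :=
    fun j _ => mul_nonneg (hu.1 j) (hu.mulVec_nonneg hA j)
  have h1 := (Finset.sum_eq_zero_iff_of_nonneg h).1 hu.2.2 i (Finset.mem_univ i)
  exact (mul_eq_zero.1 h1).resolve_left hi.ne'

/-- For small `t > 0` the vector `u + t • x` is still nonnegative, because `x` lives on the support
of `u`. The cross term vanishes there, so the value of the form is exactly `t ^ 2` times its value
at `x`. -/
lemma IsCopositiveZero.quadratic_nonneg (hA : Copositive A) {u : Fin n → ℝ}
    (hu : IsCopositiveZero A u) {x : Fin n → ℝ} (hx : ∀ i, u i = 0 → x i = 0) :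
    0 ≤ x ⬝ᵥ (A *ᵥ x) := by
  have hbound : ∃ t : ℝ, 0 < t ∧ 0 ≤ u + t • x := by
    have h : ∀ i, ∃ t : ℝ, 0 < t ∧ ∀ s, 0 < s → s ≤ t → 0 ≤ u i + s * x i := by
      intro i
      rcases (hu.1 i).eq_or_lt with h0 | h0
      · refine ⟨1, one_pos, fun s _ _ => ?_⟩
        rw [hx i h0.symm, ← h0]; simp
      · have hp : 0 < |x i| + 1 := by positivity
        refine ⟨u i / (|x i| + 1), div_pos h0 hp, fun s hs hst => ?_⟩
        have h1 : s * (|x i| + 1) ≤ u i := (le_div_iff₀ hp).1 hst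
        have h2 : s * -x i ≤ s * |x i| := by gcongr; exact neg_le_abs (x i)
        linarith
    choose t ht hts using h
    rcases isEmpty_or_nonempty (Fin n) with he | he
    · exact ⟨1, one_pos, fun i => he.elim i⟩
    · obtain ⟨i, -, hi⟩ := Finset.exists_min_image Finset.univ t Finset.univ_nonempty
      exact ⟨t i, ht i, fun j => hts j _ (ht i) (hi j (Finset.mem_univ j))⟩
  obtain ⟨t, ht, htx⟩ := hbound
  have h := hA.2 _ htx
  have h0 : x ⬝ᵥ (A *ᵥ u) = 0 := by
    apply Finset.sum_eq_zero
    intro i _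
    rcases (hu.1 i).eq_or_lt with h0 | h0
    · rw [hx i h0.symm, zero_mul]
    · rw [hu.mulVec_eq_zero hA h0, mul_zero]
  rw [hA.1.quadratic_add_smul, hu.2.2, hA.1.dotProduct_mulVec_comm u, h0] at h
  have h1 : 0 < t ^ 2 := by positivity
  have h2 : 0 ≤ t ^ 2 * (x ⬝ᵥ A *ᵥ x) := by linarith
  exact nonneg_of_mul_nonneg_right h2 h1

lemma exists_sub_smul_boundary {x u : Fin n → ℝ} (hx : 0 ≤ x) (hu : 0 ≤ u) {i : Fin n}
    (hi : 0 < u i) : ∃ c : ℝ, 0 ≤ c ∧ 0 ≤ x - c • u ∧ ∃ j, (x - c • u) j = 0 := by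
  obtain ⟨j, hj, hmin⟩ := Finset.exists_min_image {j | 0 < u j} (fun j => x j / u j)
    ⟨i, by simpa using hi⟩
  simp only [Finset.mem_filter, Finset.mem_univ, true_and] at hj hmin
  refine ⟨x j / u j, div_nonneg (hx j) hj.le, fun k => ?_, j, ?_⟩
  · rcases (hu k).eq_or_lt with hk | hk
    · have hk' : u k = 0 := hk.symm
      simpa [hk'] using hx k
    · have := (le_div_iff₀ hk).1 (hmin k hk)
      simpa using this
  · simp [hj.ne']

end QuadraticForm

/-! ### Copositivity from first-order conditions and one semi-definite window -/

/-- Vectors `u j`, positive exactly on the four cyclically consecutive indices from `j` on, that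
satisfy the first-order conditions for zeros of the form `A`. -/
structure CyclicZeros (A : Matrix (Fin 6) (Fin 6) ℝ) (u : Fin 6 → Fin 6 → ℝ) : Prop where
  symm : A.IsSymm
  pos0 : ∀ j, 0 < u j j
  pos1 : ∀ j, 0 < u j (j + 1)
  pos2 : ∀ j, 0 < u j (j + 2)
  pos3 : ∀ j, 0 < u j (j + 3)
  zero4 : ∀ j, u j (j + 4) = 0
  zero5 : ∀ j, u j (j + 5) = 0
  ker0 : ∀ j, (A *ᵥ u j) j = 0
  ker1 : ∀ j, (A *ᵥ u j) (j + 1) = 0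
  ker2 : ∀ j, (A *ᵥ u j) (j + 2) = 0
  ker3 : ∀ j, (A *ᵥ u j) (j + 3) = 0
  nonneg4 : ∀ j, 0 ≤ (A *ᵥ u j) (j + 4)
  nonneg5 : ∀ j, 0 ≤ (A *ᵥ u j) (j + 5)

namespace CyclicZeros

variable {A : Matrix (Fin 6) (Fin 6) ℝ} {u : Fin 6 → Fin 6 → ℝ}

lemma dotProduct_mulVec (h : CyclicZeros A u) (j : Fin 6) (x : Fin 6 → ℝ) :
    x ⬝ᵥ (A *ᵥ u j) =
      x (j + 4) * (A *ᵥ u j) (j + 4) + x (j + 5) * (A *ᵥ u j) (j + 5) := by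
  rw [dotProduct, sum_fin_six_shift j, h.ker0, h.ker1, h.ker2, h.ker3]
  ring

lemma quadratic_self (h : CyclicZeros A u) (j : Fin 6) : u j ⬝ᵥ (A *ᵥ u j) = 0 := by
  rw [h.dotProduct_mulVec, h.zero4, h.zero5]; ring

lemma quadratic_add (h : CyclicZeros A u) (j : Fin 6) (x : Fin 6 → ℝ) (c : ℝ) :
    (x + c • u j) ⬝ᵥ (A *ᵥ (x + c • u j)) = x ⬝ᵥ (A *ᵥ x) +
      2 * c * (x (j + 4) * (A *ᵥ u j) (j + 4) + x (j + 5) * (A *ᵥ u j) (j + 5)) := by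
  rw [h.symm.quadratic_add_smul, h.quadratic_self, h.dotProduct_mulVec]; ring

lemma nonneg (h : CyclicZeros A u) (j : Fin 6) : 0 ≤ u j :=
  fun i => forall_fin_six_shift j (p := fun i => 0 ≤ u j i) (h.pos0 j).le (h.pos1 j).le
    (h.pos2 j).le (h.pos3 j).le (h.zero4 j).ge (h.zero5 j).ge i

/-- The cross term with `u j` only sees the entries `j + 4` and `j + 5`, where `x` vanishes.
Clearing the entry `j + 3` with a multiple of `u j` therefore does not change the value. -/
lemma quadratic_nonneg_four (h : CyclicZeros A u) {j : Fin 6}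
    (hpsd : ∀ x : Fin 6 → ℝ, x (j + 3) = 0 → x (j + 4) = 0 → x (j + 5) = 0 →
      0 ≤ x ⬝ᵥ (A *ᵥ x))
    (x : Fin 6 → ℝ) (h4 : x (j + 4) = 0) (h5 : x (j + 5) = 0) : 0 ≤ x ⬝ᵥ (A *ᵥ x) := by
  set c := x (j + 3) / u j (j + 3) with hc
  have hx : x = (x - c • u j) + c • u j := by abel
  have hy4 : (x - c • u j) (j + 4) = 0 := by simp [h4, h.zero4]
  have hy5 : (x - c • u j) (j + 5) = 0 := by simp [h5, h.zero5]
  have hy3 : (x - c • u j) (j + 3) = 0 := by simp [hc, (h.pos3 j).ne']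
  rw [hx, h.quadratic_add, hy4, hy5]
  have := hpsd _ hy3 hy4 hy5
  linarith

/-- The window of four indices from `j` contains the first three indices of the window from `j + 1`,
so semi-definiteness passes from each window to the next. -/
lemma quadratic_nonneg_window (h : CyclicZeros A u)
    (hpsd : ∀ x : Fin 6 → ℝ, x 3 = 0 → x 4 = 0 → x 5 = 0 → 0 ≤ x ⬝ᵥ (A *ᵥ x))
    (j : Fin 6) (x : Fin 6 → ℝ) (h4 : x (j + 4) = 0) (h5 : x (j + 5) = 0) :
    0 ≤ x ⬝ᵥ (A *ᵥ x) := by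
  have step : ∀ j : Fin 6,
      (∀ x : Fin 6 → ℝ, x (j + 4) = 0 → x (j + 5) = 0 → 0 ≤ x ⬝ᵥ (A *ᵥ x)) →
      ∀ x : Fin 6 → ℝ, x (j + 1 + 4) = 0 → x (j + 1 + 5) = 0 → 0 ≤ x ⬝ᵥ (A *ᵥ x) := by
    intro j hj
    refine fun x => h.quadratic_nonneg_four (fun x h3 h4 _ => hj x ?_ ?_) x
    · rwa [fin_six_add_add j 1 3 4 rfl] at h3
    · rwa [fin_six_add_add j 1 4 5 rfl] at h4
  have s0 := h.quadratic_nonneg_four (j := 0) hpsd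
  have s1 := step 0 s0
  have s2 := step 1 s1
  have s3 := step 2 s2
  have s4 := step 3 s3
  have s5 := step 4 s4
  revert x
  fin_cases j
  · exact s0
  · exact s1
  · exact s2
  · exact s3
  · exact s4
  · exact s5

/-- On vectors vanishing at `j + 5`, subtracting a correction in the entries `j`, `j + 4` makes the
form positive semi-definite. -/
lemma quadratic_ge_of_apply_eq_zero (h : CyclicZeros A u)
    (hpsd : ∀ x : Fin 6 → ℝ, x 3 = 0 → x 4 = 0 → x 5 = 0 → 0 ≤ x ⬝ᵥ (A *ᵥ x))
    (j : Fin 6) (x : Fin 6 → ℝ) (h5 : x (j + 5) = 0) :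
    2 * (x j * x (j + 4)) * ((A *ᵥ u (j + 1)) j / u (j + 1) (j + 4)) ≤ x ⬝ᵥ (A *ᵥ x) := by
  have e3 : j + 1 + 3 = j + 4 := fin_six_add_add j 1 3 4 rfl
  have e4 : j + 1 + 4 = j + 5 := fin_six_add_add j 1 4 5 rfl
  have e5 : j + 1 + 5 = j := by rw [fin_six_add_add j 1 5 0 rfl, add_zero]
  have p3 := h.pos3 (j + 1)
  have z4 := h.zero4 (j + 1)
  have z5 := h.zero5 (j + 1)
  rw [e3] at p3
  rw [e4] at z4
  rw [e5] at z5
  set c := x (j + 4) / u (j + 1) (j + 4) with hc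
  have hx : x = (x - c • u (j + 1)) + c • u (j + 1) := by abel
  have hy4 : (x - c • u (j + 1)) (j + 4) = 0 := by simp [hc, p3.ne']
  have hy5 : (x - c • u (j + 1)) (j + 5) = 0 := by simp [h5, z4]
  have hy0 : (x - c • u (j + 1)) j = x j := by simp [z5]
  have hq := h.quadratic_add (j + 1) (x - c • u (j + 1)) c
  rw [e4, e5, hy5, hy0, ← hx] at hq
  have := h.quadratic_nonneg_window hpsd j _ hy4 hy5
  rw [hq]
  have e : 2 * (x j * x (j + 4)) * ((A *ᵥ u (j + 1)) j / u (j + 1) (j + 4)) =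
      2 * c * (x j * (A *ᵥ u (j + 1)) j) := by rw [hc]; ring
  linarith

lemma mulVec_succ_nonneg (h : CyclicZeros A u) (j : Fin 6) :
    0 ≤ (A *ᵥ u (j + 1)) j / u (j + 1) (j + 4) := by
  have p3 := h.pos3 (j + 1)
  have n5 := h.nonneg5 (j + 1)
  rw [fin_six_add_add j 1 3 4 rfl] at p3
  rw [fin_six_add_add j 1 5 0 rfl, add_zero] at n5
  exact div_nonneg n5 p3.le

/-- A nonnegative vector can be reduced by a nonnegative multiple of `u 0` until some entry
vanishes, and this does not increase the form. On the boundary the bound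
`quadratic_ge_of_apply_eq_zero` applies, whose correction is nonnegative for nonnegative vectors. -/
lemma copositive (h : CyclicZeros A u)
    (hpsd : ∀ x : Fin 6 → ℝ, x 3 = 0 → x 4 = 0 → x 5 = 0 → 0 ≤ x ⬝ᵥ (A *ᵥ x)) :
    Copositive A := by
  refine ⟨h.symm, fun x hx => ?_⟩
  have hz : ∀ y : Fin 6 → ℝ, 0 ≤ y → ∀ k, y k = 0 → 0 ≤ y ⬝ᵥ (A *ᵥ y) := by
    intro y hy k hk
    have e : k + 1 + 5 = k := by rw [fin_six_add_add k 1 5 0 rfl, add_zero]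
    refine le_trans (mul_nonneg (mul_nonneg zero_le_two (mul_nonneg (hy _) (hy _))) ?_)
      (h.quadratic_ge_of_apply_eq_zero hpsd (k + 1) y (by rw [e]; exact hk))
    exact h.mulVec_succ_nonneg (k + 1)
  obtain ⟨c, hc, hy, k, hk⟩ := exists_sub_smul_boundary hx (h.nonneg 0) (h.pos0 0)
  have hx' : x = (x - c • u 0) + c • u 0 := by abel
  rw [hx', h.quadratic_add]
  have h1 := hz _ hy k hk
  have h2 := mul_nonneg (hy (0 + 4)) (h.nonneg4 0)
  have h3 := mul_nonneg (hy (0 + 5)) (h.nonneg5 0)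
  have := mul_nonneg (mul_nonneg zero_le_two hc) (add_nonneg h2 h3)
  linarith

lemma of_zeros (hA : Copositive A) (hu : ∀ j, IsCopositiveZero A (u j))
    (hs : ∀ j, posSupport (u j) = cyclicFour j) : CyclicZeros A u := by
  have hmem : ∀ j i, 0 < u j i ↔ (i = j ∨ i = j + 1 ∨ i = j + 2 ∨ i = j + 3) := by
    intro j i
    have : i ∈ posSupport (u j) ↔ i ∈ cyclicFour j := by rw [hs]
    simpa [posSupport, cyclicFour] using this
  have h0 : ∀ j, 0 < u j j := fun j => (hmem j _).2 (by simp)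
  have h1 : ∀ j, 0 < u j (j + 1) := fun j => (hmem j _).2 (by simp)
  have h2 : ∀ j, 0 < u j (j + 2) := fun j => (hmem j _).2 (by simp)
  have h3 : ∀ j, 0 < u j (j + 3) := fun j => (hmem j _).2 (by simp)
  have hn : ∀ j i, ¬ (i = j ∨ i = j + 1 ∨ i = j + 2 ∨ i = j + 3) → u j i = 0 := by
    intro j i hi
    rw [← hmem] at hi
    exact le_antisymm (not_lt.1 hi) ((hu j).1 i)
  exact
    { symm := hA.1
      pos0 := h0
      pos1 := h1
      pos2 := h2
      pos3 := h3
      zero4 := fun j => hn j _ (by revert j; decide)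
      zero5 := fun j => hn j _ (by revert j; decide)
      ker0 := fun j => (hu j).mulVec_eq_zero hA (h0 j)
      ker1 := fun j => (hu j).mulVec_eq_zero hA (h1 j)
      ker2 := fun j => (hu j).mulVec_eq_zero hA (h2 j)
      ker3 := fun j => (hu j).mulVec_eq_zero hA (h3 j)
      nonneg4 := fun j => (hu j).mulVec_nonneg hA _
      nonneg5 := fun j => (hu j).mulVec_nonneg hA _ }

end CyclicZeros

lemma posSemidef_of_isSymm_of_nonneg {n : ℕ} {A : Matrix (Fin n) (Fin n) ℝ} (hA : A.IsSymm)
    (h : ∀ x, 0 ≤ x ⬝ᵥ (A *ᵥ x)) : A.PosSemidef :=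
  .of_dotProduct_mulVec_nonneg (by rw [IsHermitian, conjTranspose_eq_transpose_of_trivial, hA.eq])
    (by simpa using h)

lemma Matrix.PosSemidef.copositive {n : ℕ} {A : Matrix (Fin n) (Fin n) ℝ} (hA : A.PosSemidef) :
    Copositive A := by
  refine ⟨?_, fun x _ => by simpa using hA.dotProduct_mulVec_nonneg x⟩
  have := hA.isHermitian
  rwa [IsHermitian, conjTranspose_eq_transpose_of_trivial] at this

lemma dotProduct_vecMulVec_mulVec {n : ℕ} (x z : Fin n → ℝ) :
    z ⬝ᵥ (vecMulVec x x *ᵥ z) = (x ⬝ᵥ z) ^ 2 := by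
  rw [vecMulVec_mulVec, dotProduct_comm z]
  simp [sq]

lemma posSemidef_smul_vecMulVec {n : ℕ} {ε : ℝ} (hε : 0 ≤ ε) (x : Fin n → ℝ) :
    (ε • vecMulVec x x).PosSemidef := by
  apply posSemidef_of_isSymm_of_nonneg
  · rw [IsSymm, transpose_smul, transpose_vecMulVec]
  · intro z
    rw [smul_mulVec, dotProduct_smul, dotProduct_vecMulVec_mulVec]
    exact mul_nonneg hε (sq_nonneg _)

/-! ### Invariance under diagonal scaling -/

section DiagonalScaling

variable {n : ℕ}

/-- The simultaneous pre- and post-multiplication with a diagonal matrix. -/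
def diagScale (d : Fin n → ℝ) (A : Matrix (Fin n) (Fin n) ℝ) : Matrix (Fin n) (Fin n) ℝ :=
  diagonal d * A * diagonal d

lemma diagScale_apply (d : Fin n → ℝ) (A : Matrix (Fin n) (Fin n) ℝ) (i j : Fin n) :
    diagScale d A i j = d i * A i j * d j := by
  simp [diagScale]

lemma diagScale_add (d : Fin n → ℝ) (A B : Matrix (Fin n) (Fin n) ℝ) :
    diagScale d (A + B) = diagScale d A + diagScale d B := by
  simp [diagScale, mul_add, add_mul]

lemma diagScale_smul (d : Fin n → ℝ) (c : ℝ) (A : Matrix (Fin n) (Fin n) ℝ) :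
    diagScale d (c • A) = c • diagScale d A := by
  simp [diagScale]

lemma diagScale_inv (d : Fin n → ℝ) (hd : ∀ i, 0 < d i) (A : Matrix (Fin n) (Fin n) ℝ) :
    diagScale d⁻¹ (diagScale d A) = A := by
  ext i j
  have := (hd i).ne'
  have := (hd j).ne'
  simp only [diagScale_apply, Pi.inv_apply]
  field_simp

lemma diagScale_inv' (d : Fin n → ℝ) (hd : ∀ i, 0 < d i) (A : Matrix (Fin n) (Fin n) ℝ) :
    diagScale d (diagScale d⁻¹ A) = A := by
  simpa using diagScale_inv d⁻¹ (fun i => by simpa using hd i) A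

lemma diagScale_isSymm (d : Fin n → ℝ) {A : Matrix (Fin n) (Fin n) ℝ} (hA : A.IsSymm) :
    (diagScale d A).IsSymm := by
  ext i j
  simp only [transpose_apply, diagScale_apply, hA.apply i j]
  ring

lemma diagScale_quadratic (d : Fin n → ℝ) (A : Matrix (Fin n) (Fin n) ℝ) (x : Fin n → ℝ) :
    x ⬝ᵥ (diagScale d A *ᵥ x) = (d * x) ⬝ᵥ (A *ᵥ (d * x)) := by
  simp only [dotProduct, mulVec, diagScale_apply, Pi.mul_apply, Finset.mul_sum]
  refine Finset.sum_congr rfl fun i _ => Finset.sum_congr rfl fun j _ => ?_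
  ring

variable {d : Fin n → ℝ} {A : Matrix (Fin n) (Fin n) ℝ}

lemma Copositive.diagScale (hA : Copositive A) (hd : ∀ i, 0 < d i) :
    Copositive (diagScale d A) := by
  refine ⟨diagScale_isSymm d hA.1, fun x hx => ?_⟩
  rw [diagScale_quadratic]
  exact hA.2 _ fun i => mul_nonneg (hd i).le (hx i)

lemma IsExceptional.diagScale (hA : IsExceptional A) (hd : ∀ i, 0 < d i) :
    IsExceptional (diagScale d A) := by
  have hd' : ∀ i, 0 < d⁻¹ i := fun i => by simpa using hd i
  refine ⟨hA.1.diagScale hd, ?_⟩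
  rintro ⟨P, N, hP, hN, hN0, h⟩
  refine hA.2 ⟨_root_.diagScale d⁻¹ P, _root_.diagScale d⁻¹ N, ?_, diagScale_isSymm _ hN, ?_, ?_⟩
  · apply posSemidef_of_isSymm_of_nonneg (diagScale_isSymm _ hP.copositive.1)
    intro x
    rw [diagScale_quadratic]
    simpa using hP.dotProduct_mulVec_nonneg (d⁻¹ * x)
  · intro i j
    rw [diagScale_apply]
    exact mul_nonneg (mul_nonneg (hd' i).le (hN0 i j)) (hd' j).le
  · rw [← diagScale_add, ← h, diagScale_inv d hd]

lemma IsExtremalCopositive.diagScale (hA : IsExtremalCopositive A) (hd : ∀ i, 0 < d i) :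
    IsExtremalCopositive (diagScale d A) := by
  have hd' : ∀ i, 0 < d⁻¹ i := fun i => by simpa using hd i
  refine ⟨hA.1.diagScale hd, fun h0 => hA.2.1 ?_, fun B C hB hC h => ?_⟩
  · rw [← diagScale_inv d hd A, h0]
    simp [_root_.diagScale]
  · obtain ⟨⟨b, hb, hb'⟩, ⟨c, hc, hc'⟩⟩ := hA.2.2 _ _ (hB.diagScale hd') (hC.diagScale hd')
      (by rw [← diagScale_add, ← h, diagScale_inv d hd])
    refine ⟨⟨b, hb, ?_⟩, ⟨c, hc, ?_⟩⟩
    · rw [← diagScale_smul, ← hb', diagScale_inv' d hd]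
    · rw [← diagScale_smul, ← hc', diagScale_inv' d hd]

lemma isCopositiveZero_diagScale_iff (hd : ∀ i, 0 < d i) (v : Fin n → ℝ) :
    IsCopositiveZero (diagScale d A) v ↔ IsCopositiveZero A (d * v) := by
  have h1 : 0 ≤ v ↔ 0 ≤ d * v :=
    forall_congr' fun i => by simp [mul_nonneg_iff_of_pos_left (hd i)]
  have h2 : v = 0 ↔ d * v = 0 := by
    simp only [funext_iff, Pi.mul_apply, Pi.zero_apply, mul_eq_zero, (hd _).ne', false_or]
  rw [IsCopositiveZero, IsCopositiveZero, diagScale_quadratic, ← h1, ne_eq, ne_eq, ← h2]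

lemma posSupport_mul (hd : ∀ i, 0 < d i) (v : Fin n → ℝ) : posSupport (d * v) = posSupport v := by
  ext i
  simp [posSupport, mul_pos_iff_of_pos_left (hd i)]

lemma minimalZeroSupportSet_diagScale (hd : ∀ i, 0 < d i) :
    minimalZeroSupportSet (diagScale d A) = minimalZeroSupportSet A := by
  have hsurj : ∀ w : Fin n → ℝ, ∃ v, d * v = w := fun w =>
    ⟨d⁻¹ * w, by ext i; simp [(hd i).ne']⟩
  have hmin : ∀ v, IsMinimalZero (diagScale d A) v ↔ IsMinimalZero A (d * v) := by
    intro v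
    rw [IsMinimalZero, IsMinimalZero, isCopositiveZero_diagScale_iff hd]
    refine and_congr_right fun _ => ⟨fun h w hw => ?_, fun h w hw => ?_⟩
    · obtain ⟨w, rfl⟩ := hsurj w
      rw [posSupport_mul hd, posSupport_mul hd]
      exact h w ((isCopositiveZero_diagScale_iff hd w).2 hw)
    · have := h _ ((isCopositiveZero_diagScale_iff hd w).1 hw)
      rwa [posSupport_mul hd, posSupport_mul hd] at this
  ext S
  constructor
  · rintro ⟨v, hv, rfl⟩
    exact ⟨d * v, (hmin v).1 hv, posSupport_mul hd v⟩
  · rintro ⟨w, hw, rfl⟩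
    obtain ⟨v, rfl⟩ := hsurj w
    exact ⟨v, (hmin v).2 hw, (posSupport_mul hd v).symm⟩

lemma diagScale_mem_orbit (hd : ∀ i, 0 < d i) (A : Matrix (Fin n) (Fin n) ℝ) :
    diagScale d A ∈ MulAction.orbit (copositiveGroup n) A := by
  let g : Matrix (Fin n) (Fin n) ℝ ≃ₗ[ℝ] Matrix (Fin n) (Fin n) ℝ :=
    { toFun := diagScale d
      map_add' := diagScale_add d
      map_smul' := diagScale_smul d
      invFun := diagScale d⁻¹
      left_inv := diagScale_inv d hd
      right_inv := diagScale_inv' d hd }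
  exact ⟨⟨g, Subgroup.subset_closure (Or.inr ⟨d, hd, fun _ => rfl⟩)⟩, rfl⟩

end DiagonalScaling

/-! ### Positivity of the diagonal and the rank-one test for extremality -/

namespace CyclicZeros

variable {A : Matrix (Fin 6) (Fin 6) ℝ} {u : Fin 6 → Fin 6 → ℝ}

lemma window_apply_eq_zero_of_diag (hA : A.IsSymm) {k s : Fin 6}
    (hk : A k k = 0) (h : ∀ c : ℝ, 0 ≤ (Pi.single s 1 + c • Pi.single k 1 : Fin 6 → ℝ) ⬝ᵥ
      (A *ᵥ (Pi.single s 1 + c • Pi.single k 1))) : A k s = 0 := by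
  have hq : ∀ c : ℝ, 0 ≤ A s s + 2 * c * A k s := by
    intro c
    have := h c
    rw [hA.quadratic_add_smul] at this
    simpa [hk, hA.apply k s] using this
  by_contra hne
  have := hq (-(A s s + 1) / (2 * A k s))
  have e : 2 * (-(A s s + 1) / (2 * A k s)) * A k s = -(A s s + 1) := by field_simp
  rw [e] at this
  linarith

lemma row_eq_zero_of_diag (h : CyclicZeros A u)
    (hpsd : ∀ x : Fin 6 → ℝ, x 3 = 0 → x 4 = 0 → x 5 = 0 → 0 ≤ x ⬝ᵥ (A *ᵥ x))
    {k : Fin 6} (hk : A k k = 0) (s : Fin 6) : A k s = 0 := by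
  -- Two indices modulo 6 are at cyclic distance at most three, so some window of four contains
  -- both.
  obtain ⟨j, h1, h2, h3, h4⟩ : ∃ j : Fin 6, j + 4 ≠ k ∧ j + 5 ≠ k ∧ j + 4 ≠ s ∧ j + 5 ≠ s := by
    clear hk
    decide +revert
  refine window_apply_eq_zero_of_diag h.symm hk fun c =>
    h.quadratic_nonneg_window hpsd j _ ?_ ?_
  · simp [h1, h3]
  · simp [h2, h4]

/-- If a diagonal entry vanished, its whole row would vanish and the form would only depend on the
five other entries. There it is a positive semi-definite form plus one nonnegative off-diagonal
correction, so `A` would not be exceptional. -/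
lemma diag_pos (h : CyclicZeros A u)
    (hpsd : ∀ x : Fin 6 → ℝ, x 3 = 0 → x 4 = 0 → x 5 = 0 → 0 ≤ x ⬝ᵥ (A *ᵥ x))
    (hexc : IsExceptional A) (k : Fin 6) : 0 < A k k := by
  have hnn : 0 ≤ A k k := by
    simpa using hexc.1.2 (Pi.single k 1) (Pi.single_nonneg.2 zero_le_one)
  refine hnn.lt_of_ne' fun hk => hexc.2 ?_
  have hrow := h.row_eq_zero_of_diag hpsd hk
  obtain ⟨j, rfl⟩ : ∃ j : Fin 6, k = j + 5 := ⟨k - 5, by abel⟩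
  set δ := (A *ᵥ u (j + 1)) j / u (j + 1) (j + 4) with hδ
  have hδ0 : 0 ≤ δ := h.mulVec_succ_nonneg j
  set N : Matrix (Fin 6) (Fin 6) ℝ := δ • (single j (j + 4) 1 + single (j + 4) j 1) with hN
  have hNs : N.IsSymm := by
    rw [IsSymm, hN, transpose_smul, transpose_add, transpose_single, transpose_single, add_comm]
  have hNq : ∀ x : Fin 6 → ℝ, x ⬝ᵥ (N *ᵥ x) = 2 * (x j * x (j + 4)) * δ := by
    intro x
    rw [hN, smul_mulVec, add_mulVec, dotProduct_smul, dotProduct_add, single_mulVec,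
      single_mulVec]
    simp only [one_mul, smul_eq_mul]
    have e : ∀ (i : Fin 6) (c : ℝ), x ⬝ᵥ Function.update 0 i c = x i * c := fun i c =>
      dotProduct_single x c i
    rw [e, e]
    ring
  refine ⟨A - N, N, ?_, hNs, ?_, by abel⟩
  · refine posSemidef_of_isSymm_of_nonneg (h.symm.sub hNs) fun x => ?_
    -- Clearing the entry `j + 5` costs nothing, since its row and column are zero.
    set y : Fin 6 → ℝ := x + (-x (j + 5)) • Pi.single (j + 5) 1 with hy
    have hAe : A *ᵥ Pi.single (j + 5) 1 = 0 := by
      ext i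
      simp [h.symm.apply (j + 5) i, hrow]
    have hyA : y ⬝ᵥ (A *ᵥ y) = x ⬝ᵥ (A *ᵥ x) := by
      rw [hy, h.symm.quadratic_add_smul, hAe]; simp
    have hyj : y j = x j := by
      simp [hy]
    have hyj4 : y (j + 4) = x (j + 4) := by simp [hy]
    have := h.quadratic_ge_of_apply_eq_zero hpsd j y (by simp [hy])
    rw [hyA, hyj, hyj4] at this
    rw [sub_mulVec, dotProduct_sub, hNq]
    linarith
  · intro i l
    rw [hN, Matrix.smul_apply, Matrix.add_apply, single_apply, single_apply]
    apply mul_nonneg hδ0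
    split_ifs <;> norm_num

lemma diagScale (h : CyclicZeros A u) {d : Fin 6 → ℝ} (hd : ∀ i, 0 < d i) :
    CyclicZeros (diagScale d A) (fun j => d⁻¹ * u j) := by
  have hmul : ∀ j, _root_.diagScale d A *ᵥ (d⁻¹ * u j) = d * (A *ᵥ u j) := by
    intro j
    ext i
    simp only [mulVec, dotProduct, diagScale_apply, Pi.mul_apply, Pi.inv_apply, Finset.mul_sum]
    refine Finset.sum_congr rfl fun k _ => ?_
    have := (hd k).ne'
    field_simp
  have hd' : ∀ i, 0 < d⁻¹ i := fun i => by simpa using hd i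
  exact
    { symm := diagScale_isSymm d h.symm
      pos0 := fun j => mul_pos (hd' _) (h.pos0 j)
      pos1 := fun j => mul_pos (hd' _) (h.pos1 j)
      pos2 := fun j => mul_pos (hd' _) (h.pos2 j)
      pos3 := fun j => mul_pos (hd' _) (h.pos3 j)
      zero4 := fun j => by simp [h.zero4]
      zero5 := fun j => by simp [h.zero5]
      ker0 := fun j => by simp [hmul, h.ker0]
      ker1 := fun j => by simp [hmul, h.ker1]
      ker2 := fun j => by simp [hmul, h.ker2]
      ker3 := fun j => by simp [hmul, h.ker3]
      nonneg4 := fun j => by rw [hmul]; exact mul_nonneg (hd _).le (h.nonneg4 j)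
      nonneg5 := fun j => by rw [hmul]; exact mul_nonneg (hd _).le (h.nonneg5 j) }

/-- Subtracting `R = ε • x xᵀ` leaves every `A *ᵥ u j` unchanged and keeps the window semi-definite,
so `A - R` is copositive. By extremality `R` is a multiple of `A`; a non-zero multiple would make
`A` positive semi-definite. -/
lemma eq_zero_of_dominated (h : CyclicZeros A u) (hexc : IsExceptional A)
    (hext : IsExtremalCopositive A) {x : Fin 6 → ℝ} (hx : ∀ j, x ⬝ᵥ u j = 0) {ε : ℝ}
    (hε : 0 < ε) (hdom : ∀ z : Fin 6 → ℝ, z 3 = 0 → z 4 = 0 → z 5 = 0 →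
      ε * (x ⬝ᵥ z) ^ 2 ≤ z ⬝ᵥ (A *ᵥ z)) : x = 0 := by
  set R := ε • vecMulVec x x with hR
  have hRpsd : R.PosSemidef := posSemidef_smul_vecMulVec hε.le x
  have hRz : ∀ z, z ⬝ᵥ (R *ᵥ z) = ε * (x ⬝ᵥ z) ^ 2 := by
    intro z
    rw [hR, smul_mulVec, dotProduct_smul, dotProduct_vecMulVec_mulVec, smul_eq_mul]
  have hmul : ∀ j, (A - R) *ᵥ u j = A *ᵥ u j := by
    intro j
    rw [sub_mulVec, hR, smul_mulVec, vecMulVec_mulVec, hx]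
    simp
  have h' : CyclicZeros (A - R) u :=
    { h with
      symm := h.symm.sub hRpsd.copositive.1
      ker0 := fun j => by rw [hmul, h.ker0]
      ker1 := fun j => by rw [hmul, h.ker1]
      ker2 := fun j => by rw [hmul, h.ker2]
      ker3 := fun j => by rw [hmul, h.ker3]
      nonneg4 := fun j => by rw [hmul]; exact h.nonneg4 j
      nonneg5 := fun j => by rw [hmul]; exact h.nonneg5 j }
  have hcop : Copositive (A - R) := h'.copositive fun z h3 h4 h5 => by
    rw [sub_mulVec, dotProduct_sub, hRz]
    linarith [hdom z h3 h4 h5]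
  obtain ⟨⟨b, hb, hRb⟩, -⟩ := hext.2.2 R (A - R) hRpsd.copositive hcop (by abel)
  rcases hb.eq_or_lt with rfl | hb
  · by_contra hne
    obtain ⟨i, hi⟩ := Function.ne_iff.1 hne
    have : R i i = 0 := by rw [hRb]; simp
    rw [hR, Matrix.smul_apply, vecMulVec_apply] at this
    simp only [smul_eq_mul, mul_eq_zero, hε.ne', false_or, or_self] at this
    exact hi this
  · exfalso
    refine hexc.2 ⟨A, 0, ?_, by simp [IsSymm], fun _ _ => le_rfl, by simp⟩
    have : A = b⁻¹ • R := by rw [hRb, smul_smul, inv_mul_cancel₀ hb.ne', one_smul]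
    rw [this]
    exact hRpsd.smul (inv_nonneg.2 hb.le)

end CyclicZeros

/-! ### The recurrence defined by the zeros and its monodromy -/

/-- The companion matrix of the relation that the vector `u n` imposes on four consecutive terms of
a sequence. -/
noncomputable def stepMatrix (u : Fin 6 → Fin 6 → ℝ) (n : Fin 6) : Matrix (Fin 3) (Fin 3) ℝ :=
  !![0, 0, -(u n n / u n (n + 3));
    1, 0, -(u n (n + 1) / u n (n + 3));
    0, 1, -(u n (n + 2) / u n (n + 3))]

/-- The principal submatrix on three cyclically consecutive indices. -/
def windowMatrix (A : Matrix (Fin 6) (Fin 6) ℝ) (n : Fin 6) : Matrix (Fin 3) (Fin 3) ℝ :=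
  A.submatrix ![n, n + 1, n + 2] ![n, n + 1, n + 2]

/-- The residue of a natural number modulo `6`. -/
def cyc (n : ℕ) : Fin 6 := Fin.ofNat 6 n

lemma cyc_add (n k : ℕ) : cyc (n + k) = cyc n + cyc k := by
  simp [cyc, Fin.ext_iff, Fin.val_add]

lemma cyc_val (j : Fin 6) : cyc (j : ℕ) = j := by
  simp [cyc]

lemma cyc_add_six (n : ℕ) : cyc (n + 6) = cyc n := by
  simp [cyc, Fin.ext_iff]

/-- Three consecutive terms, from the `n`-th on, of the real sequence with initial terms `v` that
satisfies the relations imposed by the vectors `u n`. -/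
noncomputable def solution (u : Fin 6 → Fin 6 → ℝ) (v : Fin 3 → ℝ) : ℕ → Fin 3 → ℝ
  | 0 => v
  | n + 1 => solution u v n ᵥ* stepMatrix u (cyc n)

section Solution

variable (u : Fin 6 → Fin 6 → ℝ) (v : Fin 3 → ℝ) (n : ℕ)

lemma solution_succ_zero : solution u v (n + 1) 0 = solution u v n 1 := by
  simp [solution, stepMatrix, vecMul, dotProduct, Fin.sum_univ_three]

lemma solution_succ_one : solution u v (n + 1) 1 = solution u v n 2 := by
  simp [solution, stepMatrix, vecMul, dotProduct, Fin.sum_univ_three]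

lemma solution_one : solution u v n 1 = solution u v (n + 1) 0 := (solution_succ_zero u v n).symm

lemma solution_two : solution u v n 2 = solution u v (n + 2) 0 := by
  rw [← solution_succ_one, solution_one]

lemma solution_relation (h3 : u (cyc n) (cyc n + 3) ≠ 0) :
    u (cyc n) (cyc n) * solution u v n 0 + u (cyc n) (cyc n + 1) * solution u v (n + 1) 0 +
      u (cyc n) (cyc n + 2) * solution u v (n + 2) 0 + u (cyc n) (cyc n + 3) * solution u v (n + 3) 0 = 0 := by
  have h : solution u v (n + 3) 0 = solution u v (n + 1) 2 := (solution_two u v (n + 1)).symm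
  rw [h, ← solution_one u v n, ← solution_two u v n]
  have h2 : solution u v (n + 1) 2 = -(u (cyc n) (cyc n) / u (cyc n) (cyc n + 3)) * solution u v n 0
      - (u (cyc n) (cyc n + 1) / u (cyc n) (cyc n + 3)) * solution u v n 1
      - (u (cyc n) (cyc n + 2) / u (cyc n) (cyc n + 3)) * solution u v n 2 := by
    simp [solution, stepMatrix, vecMul, dotProduct, Fin.sum_univ_three]
    ring
  rw [h2]
  field_simp
  ring

lemma solution_add_six (c : ℝ) (h : solution u v 6 = c • v) :
    solution u v (n + 6) = c • solution u v n := by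
  induction n with
  | zero => simpa [solution] using h
  | succ n ih =>
    rw [show n + 1 + 6 = n + 6 + 1 by ring, solution, ih, cyc_add_six, smul_vecMul, solution]

end Solution

namespace CyclicZeros

variable {A : Matrix (Fin 6) (Fin 6) ℝ} {u : Fin 6 → Fin 6 → ℝ}

lemma apply_add_three (h : CyclicZeros A u) (n i : Fin 6) (hi : (A *ᵥ u n) i = 0) :
    A i (n + 3) = -(u n n / u n (n + 3)) * A i n - (u n (n + 1) / u n (n + 3)) * A i (n + 1)
      - (u n (n + 2) / u n (n + 3)) * A i (n + 2) := by
  rw [mulVec, dotProduct, sum_fin_six_shift n, h.zero4, h.zero5] at hi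
  have := (h.pos3 n).ne'
  field_simp
  linarith

lemma windowMatrix_eq (A : Matrix (Fin 6) (Fin 6) ℝ) (n : Fin 6) :
    windowMatrix A n = !![A n n, A n (n + 1), A n (n + 2);
      A (n + 1) n, A (n + 1) (n + 1), A (n + 1) (n + 2);
      A (n + 2) n, A (n + 2) (n + 1), A (n + 2) (n + 2)] := by
  ext i j
  fin_cases i <;> fin_cases j <;> rfl

/-- The equation `(A *ᵥ u n) i = 0`, for `i` among `n, …, n + 3`, expresses the column `n + 3`
through the three preceding ones. Passing to the next window is thus a congruence by the companion
matrix. -/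
lemma windowMatrix_succ (h : CyclicZeros A u) (n : Fin 6) :
    windowMatrix A (n + 1) = (stepMatrix u n)ᵀ * windowMatrix A n * stepMatrix u n := by
  have k0 := h.apply_add_three n n (h.ker0 n)
  have k1 := h.apply_add_three n (n + 1) (h.ker1 n)
  have k2 := h.apply_add_three n (n + 2) (h.ker2 n)
  have k3 := h.apply_add_three n (n + 3) (h.ker3 n)
  have s := h.symm.apply
  have s0 := s n (n + 3)
  have s1 := s (n + 1) (n + 3)
  have s2 := s (n + 2) (n + 3)
  have e1 : n + 1 + 1 = n + 2 := fin_six_add_add n 1 1 2 rfl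
  have e2 : n + 1 + 2 = n + 3 := fin_six_add_add n 1 2 3 rfl
  have t1 := s n (n + 1)
  have t2 := s n (n + 2)
  have t3 := s (n + 1) (n + 2)
  rw [windowMatrix_eq, windowMatrix_eq, e1, e2, stepMatrix]
  ext i j
  fin_cases i <;> fin_cases j <;>
    simp [Matrix.mul_apply, Fin.sum_univ_three]
  · rw [k1]; ring
  · rw [k2]; ring
  · rw [s1, k1, ← t1, t3]; ring
  · rw [s2, k2, ← t2, t3]; ring
  · rw [k3, s0, s1, s2, k0, k1, k2]; ring

lemma det_stepMatrix (u : Fin 6 → Fin 6 → ℝ) (n : Fin 6) :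
    (stepMatrix u n).det = -(u n n / u n (n + 3)) := by
  simp [stepMatrix, det_fin_three]

lemma det_stepMatrix_neg (h : CyclicZeros A u) (n : Fin 6) : (stepMatrix u n).det < 0 := by
  rw [det_stepMatrix]
  exact neg_neg_of_pos (div_pos (h.pos0 n) (h.pos3 n))

lemma quadratic_window {z : Fin 6 → ℝ} (h3 : z 3 = 0) (h4 : z 4 = 0) (h5 : z 5 = 0) :
    z ⬝ᵥ (A *ᵥ z) = ![z 0, z 1, z 2] ⬝ᵥ (windowMatrix A 0 *ᵥ ![z 0, z 1, z 2]) := by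
  simp [dotProduct, mulVec, Fin.sum_univ_six, Fin.sum_univ_three, windowMatrix, h3, h4, h5]

/-- A fixed vector of the monodromy gives a 6-periodic solution, that is, a vector orthogonal to all
`u j`. If the window form dominates it, extremality forces it to vanish. -/
lemma solution_six_ne (h : CyclicZeros A u) (hexc : IsExceptional A)
    (hext : IsExtremalCopositive A) {v : Fin 3 → ℝ} (hv : v ≠ 0) {ε : ℝ} (hε : 0 < ε)
    (hdom : ∀ y, ε * (v ⬝ᵥ y) ^ 2 ≤ y ⬝ᵥ (windowMatrix A 0 *ᵥ y)) : solution u v 6 ≠ v := by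
  intro h6
  have hper : ∀ n, solution u v (n + 6) = solution u v n := by
    intro n
    simpa using solution_add_six u v n 1 (by simpa using h6)
  have hmod : ∀ n, solution u v (cyc n : ℕ) = solution u v n := by
    intro n
    have hn : (cyc n : ℕ) = n % 6 := by simp [cyc]
    rw [hn]
    conv_rhs => rw [← Nat.mod_add_div n 6]
    induction n / 6 with
    | zero => simp
    | succ k ih => rw [mul_add, mul_one, ← add_assoc, hper, ih]
  set x : Fin 6 → ℝ := fun i => solution u v i 0 with hx
  have hx' : ∀ (j : Fin 6) (k : ℕ), x (j + cyc k) = solution u v ((j : ℕ) + k) 0 := by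
    intro j k
    rw [← hmod ((j : ℕ) + k), cyc_add, cyc_val]
  have hxv : ![x 0, x 1, x 2] = v := by
    ext i
    fin_cases i
    · rfl
    · exact (solution_one u v 0).symm
    · exact (solution_two u v 0).symm
  have hx0 : x = 0 := by
    refine h.eq_zero_of_dominated hexc hext (fun j => ?_) hε fun z h3 h4 h5 => ?_
    · rw [dotProduct, sum_fin_six_shift j, h.zero4, h.zero5]
      have hr := solution_relation u v (j : ℕ) (by simpa only [cyc_val] using (h.pos3 j).ne')
      rw [cyc_val] at hr
      have e1 := hx' j 1
      have e2 := hx' j 2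
      have e3 := hx' j 3
      change x (j + 1) = _ at e1
      change x (j + 2) = _ at e2
      change x (j + 3) = _ at e3
      rw [e1, e2, e3]
      linarith
    · rw [quadratic_window h3 h4 h5]
      refine le_trans (le_of_eq ?_) (hdom _)
      rw [← hxv]
      simp [dotProduct, Fin.sum_univ_six, Fin.sum_univ_three, h3, h4, h5]
  apply hv
  rw [← hxv, hx0]
  ext i
  fin_cases i <;> rfl

lemma windowMatrix_isSymm (h : CyclicZeros A u) (n : Fin 6) : (windowMatrix A n).IsSymm := by
  rw [IsSymm, windowMatrix, transpose_submatrix, h.symm.eq]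

lemma windowMatrix_quadratic_nonneg
    (hpsd : ∀ x : Fin 6 → ℝ, x 3 = 0 → x 4 = 0 → x 5 = 0 → 0 ≤ x ⬝ᵥ (A *ᵥ x)) (y : Fin 3 → ℝ) :
    0 ≤ y ⬝ᵥ (windowMatrix A 0 *ᵥ y) := by
  have h := hpsd ![y 0, y 1, y 2, 0, 0, 0] rfl rfl rfl
  have e := quadratic_window (A := A) (z := ![y 0, y 1, y 2, 0, 0, 0]) rfl rfl rfl
  have ey : ![y 0, y 1, y 2] = y := by ext i; fin_cases i <;> rfl
  rw [e] at h
  simp only [cons_val] at h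
  rwa [ey] at h

/-- If the form is definite on a window then the monodromy has a fixed vector. -/
lemma det_windowMatrix_eq_zero (h : CyclicZeros A u)
    (hpsd : ∀ x : Fin 6 → ℝ, x 3 = 0 → x 4 = 0 → x 5 = 0 → 0 ≤ x ⬝ᵥ (A *ᵥ x))
    (hexc : IsExceptional A) (hext : IsExtremalCopositive A) : (windowMatrix A 0).det = 0 := by
  by_contra hdet
  set P := windowMatrix A 0 with hP
  have hPsymm : P.IsSymm := h.windowMatrix_isSymm 0
  set S := stepMatrix u with hS
  set M := S 0 * S 1 * S 2 * S 3 * S 4 * S 5 with hM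
  have hMP : Mᵀ * P * M = P := by
    have w := h.windowMatrix_succ
    have h6 : windowMatrix A (5 + 1) = Mᵀ * P * M := by
      rw [w 5, show (5 : Fin 6) = 4 + 1 from rfl, w 4, show (4 : Fin 6) = 3 + 1 from rfl, w 3,
        show (3 : Fin 6) = 2 + 1 from rfl, w 2, show (2 : Fin 6) = 1 + 1 from rfl, w 1,
        show (1 : Fin 6) = 0 + 1 from rfl, w 0]
      simp only [hM, transpose_mul, Matrix.mul_assoc]
      rfl
    rw [← h6]; rfl
  have hMdet : M.det = 1 := by
    have h1 : M.det * M.det = 1 := by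
      have := congrArg det hMP
      rw [det_mul, det_mul, det_transpose] at this
      have h2 : P.det * (M.det * M.det) = P.det * 1 := by linarith
      exact mul_left_cancel₀ hdet h2
    -- There are six companion factors, an even number, each of negative determinant.
    have h2 : 0 < M.det := by
      have n := h.det_stepMatrix_neg
      rw [hM, det_mul, det_mul, det_mul, det_mul, det_mul]
      exact mul_pos_of_neg_of_neg (mul_neg_of_pos_of_neg (mul_pos_of_neg_of_neg
        (mul_neg_of_pos_of_neg (mul_pos_of_neg_of_neg (n 0) (n 1)) (n 2)) (n 3)) (n 4)) (n 5)
    nlinarith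
  have hM1 : (M - 1).det = 0 := by
    have e : Mᵀ * P * (M - 1) = (1 - M)ᵀ * P := by
      rw [Matrix.mul_sub, hMP, Matrix.mul_one, transpose_sub, transpose_one, Matrix.sub_mul,
        Matrix.one_mul]
    have e' := congrArg det e
    -- The dimension 3 is odd; this sign makes the determinant of `M - 1` equal to its own negative.
    have hneg : (1 - M).det = -(M - 1).det := by
      rw [← neg_sub, det_neg, Fintype.card_fin]; ring
    rw [det_mul, det_mul, det_mul, det_transpose, det_transpose, hMdet, hneg] at e'
    have : P.det * (M - 1).det = 0 := by linarith
    exact (mul_eq_zero.1 this).resolve_left hdet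
  obtain ⟨v, hv, hvM⟩ := exists_vecMul_eq_zero_iff.2 hM1
  have hvM' : v ᵥ* M = v := by
    rw [vecMul_sub, vecMul_one] at hvM
    exact sub_eq_zero.1 hvM
  have h6 : solution u v 6 = v := by
    conv_rhs => rw [← hvM']
    rw [hM, ← vecMul_vecMul, ← vecMul_vecMul, ← vecMul_vecMul, ← vecMul_vecMul, ← vecMul_vecMul]
    rfl
  set w := P⁻¹ *ᵥ v with hw
  have hPw : P *ᵥ w = v := by
    rw [hw, mulVec_mulVec, mul_nonsing_inv _ (isUnit_iff_ne_zero.2 hdet), one_mulVec]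
  have hPpsd := windowMatrix_quadratic_nonneg hpsd
  rw [← hP] at hPpsd
  -- By Cauchy–Schwarz for `P`, `(v ⬝ᵥ y) ^ 2` is at most `w ⬝ᵥ (P *ᵥ w)` times the form at `y`. The
  -- summand 1 gives a positive constant without first showing that this factor is non-zero.
  have hden : 0 < 1 + w ⬝ᵥ (P *ᵥ w) := by linarith [hPpsd w]
  refine h.solution_six_ne hexc hext hv (inv_pos.2 hden) (fun y => ?_) h6
  have hquad : ∀ t : ℝ, 0 ≤ (y ⬝ᵥ (P *ᵥ y)) * (t * t) + 2 * (v ⬝ᵥ y) * t + w ⬝ᵥ (P *ᵥ w) := by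
    intro t
    have := hPpsd (w + t • y)
    rw [hPsymm.quadratic_add_smul, hPsymm.dotProduct_mulVec_comm w y, hPw,
      dotProduct_comm y v] at this
    rw [hPw]
    linarith
  have hd := discrim_le_zero hquad
  rw [discrim] at hd
  rw [← hP, inv_mul_le_iff₀ hden]
  nlinarith [hPpsd y]

end CyclicZeros

/-! ### Unit complex numbers and planar Gram matrices -/

section Complex

open ComplexConjugate

lemma Complex.div_re_of_norm_one {x : ℂ} (hx : ‖x‖ = 1) (y : ℂ) :
    (y / x).re = x.re * y.re + x.im * y.im := by
  rw [Complex.div_re, Complex.normSq_eq_norm_sq, hx]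
  ring

lemma Complex.re_sq_add_im_sq_of_norm_one {x : ℂ} (hx : ‖x‖ = 1) : x.re ^ 2 + x.im ^ 2 = 1 := by
  have := Complex.sq_norm x
  rw [hx, Complex.normSq_apply] at this
  linarith

lemma Complex.norm_eq_one_of_sq_add_sq {x : ℂ} (h : x.re * x.re + x.im * x.im = 1) : ‖x‖ = 1 := by
  have := Complex.sq_norm x
  rw [Complex.normSq_apply, h] at this
  nlinarith [norm_nonneg x]

lemma Complex.eq_or_eq_conj_of_re_eq {z w : ℂ} (hz : ‖z‖ = 1) (hw : ‖w‖ = 1)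
    (h : z.re = w.re) : w = z ∨ w = conj z := by
  have h1 := Complex.re_sq_add_im_sq_of_norm_one hz
  have h2 := Complex.re_sq_add_im_sq_of_norm_one hw
  rw [h] at h1
  rcases sq_eq_sq_iff_eq_or_eq_neg.1 (by linarith : w.im ^ 2 = z.im ^ 2) with h3 | h3
  · exact Or.inl (Complex.ext h.symm h3)
  · exact Or.inr (Complex.ext (by simp [h]) (by simp [h3]))

lemma Complex.conj_eq_inv_of_norm_one {z : ℂ} (hz : ‖z‖ = 1) : conj z = z⁻¹ :=
  (Complex.inv_eq_conj hz).symm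

/-- Two triples of unit complex numbers with the same Gram matrix are congruent. -/
lemma Complex.exists_rotation_or_reflection {a b c a' b' c' : ℂ} (ha : ‖a‖ = 1) (hb : ‖b‖ = 1)
    (hc : ‖c‖ = 1) (ha' : ‖a'‖ = 1) (hb' : ‖b'‖ = 1) (hc' : ‖c'‖ = 1)
    (hab : (b / a).re = (b' / a').re) (hac : (c / a).re = (c' / a').re)
    (hbc : (c / b).re = (c' / b').re) :
    (∃ ω : ℂ, ‖ω‖ = 1 ∧ a' = ω * a ∧ b' = ω * b ∧ c' = ω * c) ∨
      ∃ ω : ℂ, ‖ω‖ = 1 ∧ a' = ω * conj a ∧ b' = ω * conj b ∧ c' = ω * conj c := by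
  have na : a ≠ 0 := norm_ne_zero_iff.1 (by rw [ha]; exact one_ne_zero)
  have na' : a' ≠ 0 := norm_ne_zero_iff.1 (by rw [ha']; exact one_ne_zero)
  obtain ⟨z, rfl⟩ : ∃ z, b = z * a := ⟨b / a, by field_simp⟩
  obtain ⟨w, rfl⟩ : ∃ w, c = w * a := ⟨c / a, by field_simp⟩
  obtain ⟨z', rfl⟩ : ∃ z', b' = z' * a' := ⟨b' / a', by field_simp⟩
  obtain ⟨w', rfl⟩ : ∃ w', c' = w' * a' := ⟨c' / a', by field_simp⟩
  rw [norm_mul, ha, mul_one] at hb hc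
  rw [norm_mul, ha', mul_one] at hb' hc'
  rw [mul_div_cancel_right₀ _ na, mul_div_cancel_right₀ _ na'] at hab hac
  rw [mul_div_mul_right _ _ na, mul_div_mul_right _ _ na', Complex.div_re_of_norm_one hb,
    Complex.div_re_of_norm_one hb'] at hbc
  have rot : z' = z → w' = w → ∃ ω : ℂ, ‖ω‖ = 1 ∧ a' = ω * a ∧ z' * a' = ω * (z * a) ∧
      w' * a' = ω * (w * a) := by
    rintro rfl rfl
    refine ⟨a' / a, by rw [norm_div, ha, ha', div_one], ?_, ?_, ?_⟩ <;> field_simp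
  have ref : z' = conj z → w' = conj w → ∃ ω : ℂ, ‖ω‖ = 1 ∧ a' = ω * conj a ∧
      z' * a' = ω * conj (z * a) ∧ w' * a' = ω * conj (w * a) := by
    rintro rfl rfl
    have haa : a * conj a = 1 := by
      rw [Complex.conj_eq_inv_of_norm_one ha, mul_inv_cancel₀ na]
    refine ⟨a' * a, by rw [norm_mul, ha, ha', mul_one], ?_, ?_, ?_⟩
    · linear_combination (-a') * haa
    · rw [map_mul]; linear_combination (-a' * conj z) * haa
    · rw [map_mul]; linear_combination (-a' * conj w) * haa
  rcases Complex.eq_or_eq_conj_of_re_eq hb hb' hab with h1 | h1 <;>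
    rcases Complex.eq_or_eq_conj_of_re_eq hc hc' hac with h2 | h2
  · exact Or.inl (rot h1 h2)
  -- In the mixed cases the third inner product forces one of the two ratios to be real, hence equal
  -- to its conjugate.
  · have him : z.im * w.im = 0 := by
      rw [h1, h2] at hbc
      simp only [Complex.conj_re, Complex.conj_im] at hbc
      linarith
    rcases mul_eq_zero.1 him with h3 | h3
    · exact Or.inr (ref (by rw [h1, Complex.conj_eq_iff_im.2 h3]) h2)
    · exact Or.inl (rot h1 (by rw [h2, Complex.conj_eq_iff_im.2 h3]))
  · have him : z.im * w.im = 0 := by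
      rw [h1, h2] at hbc
      simp only [Complex.conj_re, Complex.conj_im] at hbc
      linarith
    rcases mul_eq_zero.1 him with h3 | h3
    · exact Or.inl (rot (by rw [h1, Complex.conj_eq_iff_im.2 h3]) h2)
    · exact Or.inr (ref h1 (by rw [h2, Complex.conj_eq_iff_im.2 h3]))
  · exact Or.inr (ref h1 h2)

end Complex

/-- With unit diagonal, `P` is the Gram matrix of `(1, 0)` and two plane unit vectors with first
coordinates `P 0 1` and `P 0 2`. Vanishing of the determinant says that `P 1 2` is their inner
product for one choice `τ` of the relative sign of the second coordinates. -/
lemma exists_eq_vecMulVec_add_vecMulVec {P : Matrix (Fin 3) (Fin 3) ℝ} (hs : P.IsSymm)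
    (hd : ∀ i, P i i = 1) (hpsd : ∀ y, 0 ≤ y ⬝ᵥ (P *ᵥ y)) (hdet : P.det = 0) :
    ∃ p q : Fin 3 → ℝ, P = vecMulVec p p + vecMulVec q q := by
  have h10 := hs.apply 0 1
  have h20 := hs.apply 0 2
  have h21 := hs.apply 1 2
  have b01 : 0 ≤ 1 - P 0 1 ^ 2 := by
    have := hpsd ![-P 0 1, 1, 0]
    simp [dotProduct, mulVec, Fin.sum_univ_three, hd, h10] at this
    nlinarith
  have b02 : 0 ≤ 1 - P 0 2 ^ 2 := by
    have := hpsd ![-P 0 2, 0, 1]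
    simp [dotProduct, mulVec, Fin.sum_univ_three, hd, h20] at this
    nlinarith
  have hsq : (P 1 2 - P 0 1 * P 0 2) ^ 2 =
      (√(1 - P 0 1 ^ 2) * √(1 - P 0 2 ^ 2)) ^ 2 := by
    rw [mul_pow, Real.sq_sqrt b01, Real.sq_sqrt b02]
    rw [det_fin_three, h10, h20, h21, hd, hd, hd] at hdet
    linarith
  obtain ⟨τ, hτ, hτ'⟩ : ∃ τ : ℝ, τ ^ 2 = 1 ∧
      P 1 2 - P 0 1 * P 0 2 = √(1 - P 0 1 ^ 2) * (τ * √(1 - P 0 2 ^ 2)) := by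
    rcases sq_eq_sq_iff_eq_or_eq_neg.1 hsq with h | h
    · exact ⟨1, by norm_num, by rw [h]; ring⟩
    · exact ⟨-1, by norm_num, by rw [h]; ring⟩
  have e1 := Real.sq_sqrt b01
  have e2 := Real.sq_sqrt b02
  refine ⟨![1, P 0 1, P 0 2], ![0, √(1 - P 0 1 ^ 2), τ * √(1 - P 0 2 ^ 2)], ?_⟩
  ext i j
  fin_cases i <;> fin_cases j <;> simp [hd, h10, h20, h21]
  · linarith
  · linarith
  · linarith
  · linear_combination (-τ ^ 2) * e2 + (-1 + P 0 2 ^ 2) * hτ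

section Solution

variable (u : Fin 6 → Fin 6 → ℝ)

lemma solution_smul_add_smul (a b : ℝ) (p q : Fin 3 → ℝ) (n : ℕ) :
    solution u (a • p + b • q) n = a • solution u p n + b • solution u q n := by
  induction n with
  | zero => rfl
  | succ n ih => rw [solution, ih, add_vecMul, smul_vecMul, smul_vecMul]; rfl

end Solution

/-! ### Representation of the form by a sequence of plane vectors -/

namespace CyclicZeros

variable {A : Matrix (Fin 6) (Fin 6) ℝ} {u : Fin 6 → Fin 6 → ℝ}

lemma windowMatrix_solution (h : CyclicZeros A u) {p q : Fin 3 → ℝ}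
    (hpq : windowMatrix A 0 = vecMulVec p p + vecMulVec q q) (n : ℕ) :
    windowMatrix A (cyc n) = vecMulVec (solution u p n) (solution u p n) +
      vecMulVec (solution u q n) (solution u q n) := by
  have hv : ∀ (v : Fin 3 → ℝ) (S : Matrix (Fin 3) (Fin 3) ℝ),
      vecMulVec (v ᵥ* S) (v ᵥ* S) = Sᵀ * vecMulVec v v * S := by
    intro v S
    rw [mul_vecMulVec, vecMulVec_mul, mulVec_transpose]
  induction n with
  | zero => exact hpq
  | succ n ih =>
    rw [cyc_add, show cyc 1 = 1 from rfl, h.windowMatrix_succ, ih, solution, solution, hv, hv,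
      Matrix.mul_add, Matrix.add_mul]

lemma gram_le_two (h : CyclicZeros A u) {p q : Fin 3 → ℝ}
    (hpq : windowMatrix A 0 = vecMulVec p p + vecMulVec q q) (n : ℕ) :
    solution u p n 0 * solution u p n 0 + solution u q n 0 * solution u q n 0 =
        A (cyc n) (cyc n) ∧
      solution u p n 0 * solution u p (n + 1) 0 + solution u q n 0 * solution u q (n + 1) 0 =
        A (cyc n) (cyc (n + 1)) ∧
      solution u p n 0 * solution u p (n + 2) 0 + solution u q n 0 * solution u q (n + 2) 0 =
        A (cyc n) (cyc (n + 2)) := by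
  have hw := h.windowMatrix_solution hpq n
  rw [windowMatrix_eq] at hw
  refine ⟨?_, ?_, ?_⟩
  · have := congrFun (congrFun hw 0) 0
    simpa [vecMulVec_apply] using this.symm
  · have := congrFun (congrFun hw 0) 1
    rw [cyc_add, show cyc 1 = 1 from rfl, ← solution_one, ← solution_one]
    simpa [vecMulVec_apply] using this.symm
  · have := congrFun (congrFun hw 0) 2
    rw [cyc_add, show cyc 2 = 2 from rfl, ← solution_two, ← solution_two]
    simpa [vecMulVec_apply] using this.symm

lemma sum_mulVec (h : CyclicZeros A u) (n : ℕ) (i : Fin 6) :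
    (A *ᵥ u (cyc n)) i = u (cyc n) (cyc n) * A i (cyc n) +
      u (cyc n) (cyc n + 1) * A i (cyc (n + 1)) + u (cyc n) (cyc n + 2) * A i (cyc (n + 2)) +
      u (cyc n) (cyc n + 3) * A i (cyc (n + 3)) := by
  rw [mulVec, dotProduct, sum_fin_six_shift (cyc n), h.zero4, h.zero5, cyc_add n 1, cyc_add n 2,
    cyc_add n 3]
  change A i (cyc n) * _ + A i (cyc n + 1) * _ + A i (cyc n + 2) * _ + A i (cyc n + 3) * _ +
    _ * 0 + _ * 0 = _ * _ + _ * A i (cyc n + 1) + _ * A i (cyc n + 2) + _ * A i (cyc n + 3)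
  ring

lemma gram_three (h : CyclicZeros A u) {p q : Fin 3 → ℝ}
    (hpq : windowMatrix A 0 = vecMulVec p p + vecMulVec q q) (n : ℕ) :
    solution u p n 0 * solution u p (n + 3) 0 + solution u q n 0 * solution u q (n + 3) 0 =
        A (cyc n) (cyc (n + 3)) := by
  obtain ⟨g0, g1, g2⟩ := h.gram_le_two hpq n
  have h3 := (h.pos3 (cyc n)).ne'
  have rp := solution_relation u p n h3
  have rq := solution_relation u q n h3
  have hA := h.sum_mulVec n (cyc n)
  rw [h.ker0, ← g0, ← g1, ← g2] at hA
  apply mul_left_cancel₀ h3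
  linear_combination hA + solution u p n 0 * rp + solution u q n 0 * rq

/-- The entries of row `n + 4` at `n + 1`, `n + 2`, `n + 3` are inner products of the sequence. The
entry at `n` is read instead as the one at `n + 6`, at distance two. Subtracting the recurrence from
`0 ≤ (A *ᵥ u n) (n + 4)` leaves only the mismatch between the terms `n + 6` and `n`. -/
lemma gram_four (h : CyclicZeros A u) {p q : Fin 3 → ℝ}
    (hpq : windowMatrix A 0 = vecMulVec p p + vecMulVec q q) (n : ℕ) :
    solution u p n 0 * solution u p (n + 4) 0 + solution u q n 0 * solution u q (n + 4) 0 ≤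
      solution u p (n + 4) 0 * solution u p (n + 6) 0 +
        solution u q (n + 4) 0 * solution u q (n + 6) 0 := by
  have g3 := h.gram_three hpq (n + 1)
  obtain ⟨-, -, g2⟩ := h.gram_le_two hpq (n + 2)
  obtain ⟨-, g1, -⟩ := h.gram_le_two hpq (n + 3)
  obtain ⟨-, -, g2'⟩ := h.gram_le_two hpq (n + 4)
  rw [add_assoc, show 2 + 2 = 4 from rfl] at g2
  rw [add_assoc n, show 1 + 3 = 4 from rfl] at g3
  rw [add_assoc n, show 3 + 1 = 4 from rfl] at g1
  rw [add_assoc n, show 4 + 2 = 6 from rfl, cyc_add_six] at g2'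
  have h0 := h.pos0 (cyc n)
  have h3 := (h.pos3 (cyc n)).ne'
  have rp := solution_relation u p n h3
  have rq := solution_relation u q n h3
  have hA := h.sum_mulVec n (cyc (n + 4))
  have hnn := h.nonneg4 (cyc n)
  have e4 : cyc n + 4 = cyc (n + 4) := by rw [cyc_add]; rfl
  have s := h.symm.apply
  rw [e4, hA, s (cyc (n + 1)), s (cyc (n + 2)), s (cyc (n + 3)), ← g1, ← g2, ← g3, ← g2'] at hnn
  rw [← sub_nonneg]
  refine nonneg_of_mul_nonneg_right (le_trans hnn (le_of_eq ?_)) h0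
  linear_combination solution u p (n + 4) 0 * rp + solution u q (n + 4) 0 * rq

open ComplexConjugate in
/-- The form is represented, near the diagonal, by a sequence of unit vectors in the plane on which
the shift by six acts as a non-trivial rotation. -/
lemma exists_unit_sequence (h : CyclicZeros A u)
    (hpsd : ∀ x : Fin 6 → ℝ, x 3 = 0 → x 4 = 0 → x 5 = 0 → 0 ≤ x ⬝ᵥ (A *ᵥ x))
    (hexc : IsExceptional A) (hext : IsExtremalCopositive A) (hdiag : ∀ i, A i i = 1) :
    ∃ (g : ℕ → ℂ) (ω : ℂ), (∀ n, ‖g n‖ = 1) ∧ ‖ω‖ = 1 ∧ ω ≠ 1 ∧ (∀ n, g (n + 6) = ω * g n) ∧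
      (∀ n, (g (n + 1) / g n).re = A (cyc n) (cyc (n + 1))) ∧
      (∀ n, (g (n + 2) / g n).re = A (cyc n) (cyc (n + 2))) ∧
      (∀ n, (g (n + 3) / g n).re = A (cyc n) (cyc (n + 3))) ∧
      (∀ n, ∃ a b c d : ℝ, 0 < a ∧ 0 < b ∧ 0 < c ∧ 0 < d ∧
        a * g n + b * g (n + 1) + c * g (n + 2) + d * g (n + 3) = 0) ∧
      ∀ n, (g (n + 4) / g n).re ≤ (g (n + 6) / g (n + 4)).re := by
  obtain ⟨p, q, hpq⟩ := exists_eq_vecMulVec_add_vecMulVec (h.windowMatrix_isSymm 0)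
    (fun i => hdiag _) (windowMatrix_quadratic_nonneg hpsd)
    (h.det_windowMatrix_eq_zero hpsd hexc hext)
  set g : ℕ → ℂ := fun n => ⟨solution u p n 0, solution u q n 0⟩ with hg
  have hnorm : ∀ n, ‖g n‖ = 1 := fun n =>
    Complex.norm_eq_one_of_sq_add_sq (by rw [← hdiag (cyc n)]; exact (h.gram_le_two hpq n).1)
  have h1 : ∀ n, (g (n + 1) / g n).re = A (cyc n) (cyc (n + 1)) := fun n => by
    rw [Complex.div_re_of_norm_one (hnorm n)]; exact (h.gram_le_two hpq n).2.1
  have h2 : ∀ n, (g (n + 2) / g n).re = A (cyc n) (cyc (n + 2)) := fun n => by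
    rw [Complex.div_re_of_norm_one (hnorm n)]; exact (h.gram_le_two hpq n).2.2
  have h3 : ∀ n, (g (n + 3) / g n).re = A (cyc n) (cyc (n + 3)) := fun n => by
    rw [Complex.div_re_of_norm_one (hnorm n)]; exact h.gram_three hpq n
  have h4 : ∀ n, (g (n + 4) / g n).re ≤ (g (n + 6) / g (n + 4)).re := fun n => by
    rw [Complex.div_re_of_norm_one (hnorm n), Complex.div_re_of_norm_one (hnorm _)]
    exact h.gram_four hpq n
  have hrel : ∀ n, (u (cyc n) (cyc n) : ℂ) * g n + (u (cyc n) (cyc n + 1) : ℝ) * g (n + 1) +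
      (u (cyc n) (cyc n + 2) : ℝ) * g (n + 2) + (u (cyc n) (cyc n + 3) : ℝ) * g (n + 3) = 0 := by
    intro n
    have hne := (h.pos3 (cyc n)).ne'
    apply Complex.ext
    · simpa [hg] using solution_relation u p n hne
    · simpa [hg] using solution_relation u q n hne
  -- If the components along a unit vector `v` are fixed by the monodromy, they form a solution that
  -- the window form dominates with constant 1, so they vanish.
  have hfix : ∀ v : ℂ, ‖v‖ = 1 → (g 6 / v).re = (g 0 / v).re → (g 7 / v).re = (g 1 / v).re →
      (g 8 / v).re = (g 2 / v).re →
      (g 0 / v).re = 0 ∧ (g 1 / v).re = 0 ∧ (g 2 / v).re = 0 := by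
    intro v hv e0 e1 e2
    simp only [Complex.div_re_of_norm_one hv] at e0 e1 e2 ⊢
    have hsol : ∀ n, v.re * (g n).re + v.im * (g n).im =
        solution u (v.re • p + v.im • q) n 0 := by
      intro n; rw [solution_smul_add_smul]; rfl
    simp only [hsol] at e0 e1 e2 ⊢
    set w := v.re • p + v.im • q with hw
    have hw6 : solution u w 6 = w := by
      ext i
      fin_cases i
      · exact e0
      · exact (solution_one u w 6).trans (e1.trans (solution_one u w 0).symm)
      · exact (solution_two u w 6).trans (e2.trans (solution_two u w 0).symm)
    have hw0 : w = 0 := by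
      by_contra hne
      refine h.solution_six_ne hexc hext hne one_pos (fun y => ?_) hw6
      rw [hpq, add_mulVec, dotProduct_add, dotProduct_vecMulVec_mulVec,
        dotProduct_vecMulVec_mulVec, hw, add_dotProduct, smul_dotProduct, smul_dotProduct,
        smul_eq_mul, smul_eq_mul, one_mul]
      have hn := Complex.re_sq_add_im_sq_of_norm_one hv
      have e : (p ⬝ᵥ y) ^ 2 + (q ⬝ᵥ y) ^ 2 =
          (v.re ^ 2 + v.im ^ 2) * ((p ⬝ᵥ y) ^ 2 + (q ⬝ᵥ y) ^ 2) := by rw [hn, one_mul]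
      rw [e]
      nlinarith [sq_nonneg (v.re * (q ⬝ᵥ y) - v.im * (p ⬝ᵥ y))]
    rw [← solution_one u w 0, ← solution_two u w 0, solution, hw0]
    exact ⟨rfl, rfl, rfl⟩
  have hne : ∀ n, g n ≠ 0 := fun n => norm_ne_zero_iff.1 (by rw [hnorm]; exact one_ne_zero)
  obtain ⟨ω, hω, r0, r1, r2⟩ : ∃ ω : ℂ, ‖ω‖ = 1 ∧ g 6 = ω * g 0 ∧ g 7 = ω * g 1 ∧
      g 8 = ω * g 2 := by
    rcases Complex.exists_rotation_or_reflection (hnorm 0) (hnorm 1) (hnorm 2) (hnorm 6) (hnorm 7)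
      (hnorm 8) ((h1 0).trans (h1 6).symm) ((h2 0).trans (h2 6).symm)
      ((h1 1).trans (h1 7).symm) with hrot | ⟨ω, hω, r0, r1, r2⟩
    · exact hrot
    -- The reflection `x ↦ ω * conj x` fixes a square root `v` of `ω`. By `hfix` the three vectors
    -- are then orthogonal to `v`, where the reflection acts as the rotation by `-1`.
    · obtain ⟨v, hv⟩ := IsAlgClosed.exists_pow_nat_eq ω zero_lt_two
      have hv1 : ‖v‖ = 1 := by
        have : ‖v‖ ^ 2 = 1 := by rw [← norm_pow, hv, hω]
        nlinarith [norm_nonneg v]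
      have hv0 : v ≠ 0 := norm_ne_zero_iff.1 (by rw [hv1]; exact one_ne_zero)
      have hre : ∀ x y : ℂ, y = ω * conj x → (y / v).re = (x / v).re := by
        rintro x y rfl
        rw [← hv, show v ^ 2 * conj x / v = v * conj x by field_simp,
          Complex.div_re_of_norm_one hv1, Complex.mul_re, Complex.conj_re, Complex.conj_im]
        ring
      obtain ⟨z0, z1, z2⟩ := hfix v hv1 (hre _ _ r0) (hre _ _ r1) (hre _ _ r2)
      have hneg : ∀ x : ℂ, (x / v).re = 0 → ω * conj x = -1 * x := by
        intro x hx
        have hc : conj (x / v) = -(x / v) := Complex.ext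
          (by rw [Complex.conj_re, Complex.neg_re, hx, neg_zero])
          (by rw [Complex.conj_im, Complex.neg_im])
        rw [map_div₀, Complex.conj_eq_inv_of_norm_one hv1, div_inv_eq_mul] at hc
        have : v * (conj x * v) = v * -(x / v) := by rw [hc]
        rw [← hv]
        field_simp at this
        linear_combination this
      exact ⟨-1, by simp, r0.trans (hneg _ z0), r1.trans (hneg _ z1), r2.trans (hneg _ z2)⟩
  have hper : ∀ n, g (n + 6) = ω * g n ∧ g (n + 1 + 6) = ω * g (n + 1) ∧
      g (n + 2 + 6) = ω * g (n + 2) := by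
    intro n
    induction n with
    | zero => exact ⟨r0, r1, r2⟩
    | succ n ih =>
      obtain ⟨i0, i1, i2⟩ := ih
      refine ⟨i1, i2, ?_⟩
      have e := hrel n
      have e' := hrel (n + 6)
      have hu : ((u (cyc n) (cyc n + 3) : ℝ) : ℂ) ≠ 0 :=
        Complex.ofReal_ne_zero.2 (h.pos3 _).ne'
      rw [cyc_add_six, show n + 6 + 1 = n + 1 + 6 by ring, show n + 6 + 2 = n + 2 + 6 by ring,
        show n + 6 + 3 = n + 1 + 2 + 6 by ring, i0, i1, i2] at e'
      rw [show n + 3 = n + 1 + 2 by ring] at e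
      apply mul_left_cancel₀ hu
      linear_combination e' - ω * e
  refine ⟨g, ω, hnorm, hω, ?_, fun n => (hper n).1, h1, h2, h3, fun n => ?_, h4⟩
  -- With trivial rotation, `hfix` along `g 0` would make the component of `g 0` along itself
  -- vanish.
  · rintro rfl
    rw [one_mul] at r0 r1 r2
    have := (hfix (g 0) (hnorm 0) (by rw [r0]) (by rw [r1]) (by rw [r2])).1
    rw [div_self (hne 0)] at this
    exact one_ne_zero this
  · exact ⟨_, _, _, _, h.pos0 (cyc n), h.pos1 (cyc n), h.pos2 (cyc n), h.pos3 (cyc n), hrel n⟩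

end CyclicZeros

/-! ### Signs and angles of the plane sequence -/

section Angles

open ComplexConjugate

variable {g : ℕ → ℂ} {ω ρ : ℂ} {s : ℕ → ℝ}

/-- Writing `g (n + 3) / g n = w * ρ`, the next ratio is `conj w * ρ`. Equality of their real parts
gives `w.im * ρ.im = 0`, so the unit number `w` is real. -/
lemma exists_sign_of_rotation (hg : ∀ n, ‖g n‖ = 1) (hper : ∀ n, g (n + 6) = ρ ^ 2 * g n)
    (hρ : ‖ρ‖ = 1) (hκ : 0 < ρ.im)
    (h3 : ∀ n, (g (n + 3) / g n).re = (g (n + 6) / g (n + 3)).re) (n : ℕ) :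
    ∃ s : ℝ, s ^ 2 = 1 ∧ g (n + 3) = s * ρ * g n := by
  have hne : ∀ n, g n ≠ 0 := fun n => norm_ne_zero_iff.1 (by rw [hg]; exact one_ne_zero)
  have hρ0 : ρ ≠ 0 := norm_ne_zero_iff.1 (by rw [hρ]; exact one_ne_zero)
  set w := g (n + 3) / g n / ρ with hw
  have hw1 : ‖w‖ = 1 := by rw [hw, norm_div, norm_div, hg, hg, hρ]; norm_num
  have hw0 : w ≠ 0 := norm_ne_zero_iff.1 (by rw [hw1]; exact one_ne_zero)
  have e1 : g (n + 3) = w * ρ * g n := by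
    have := hne n
    rw [hw]; field_simp
  have e2 : g (n + 3) / g n = w * ρ := by rw [e1, mul_div_cancel_right₀ _ (hne n)]
  have e3 : g (n + 6) / g (n + 3) = conj w * ρ := by
    have := hne n
    rw [hper, e1, Complex.conj_eq_inv_of_norm_one hw1]; field_simp
  have h := h3 n
  rw [e2, e3, Complex.mul_re, Complex.mul_re, Complex.conj_re, Complex.conj_im] at h
  have him : w.im = 0 := by
    have : w.im * ρ.im = 0 := by linarith
    exact (mul_eq_zero.1 this).resolve_right hκ.ne'
  have hwr : w = (w.re : ℂ) := Complex.ext rfl (by simpa using him)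
  refine ⟨w.re, ?_, by rw [← hwr]; exact e1⟩
  have := Complex.re_sq_add_im_sq_of_norm_one hw1
  rw [him] at this
  linarith

lemma eq_of_sq_eq_one_of_mul_pos {s t : ℝ} (hs : s ^ 2 = 1) (ht : t ^ 2 = 1) {y : ℝ}
    (hy : y ≠ 0) (h1 : 0 ≤ s * y) (h2 : 0 ≤ t * y) : s = t := by
  rcases sq_eq_one_iff.1 hs with rfl | rfl <;>
    rcases sq_eq_one_iff.1 ht with rfl | rfl
  · rfl
  · exact absurd (by linarith : y = 0) hy
  · exact absurd (by linarith : y = 0) hy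
  · rfl

lemma sign_periodic (hg : ∀ n, ‖g n‖ = 1) (hper : ∀ n, g (n + 6) = ρ ^ 2 * g n) (hρ : ‖ρ‖ = 1)
    (hs : ∀ n, s n ^ 2 = 1) (hgs : ∀ n, g (n + 3) = s n * ρ * g n) (n : ℕ) :
    s (n + 3) = s n := by
  have hne : g n ≠ 0 := norm_ne_zero_iff.1 (by rw [hg]; exact one_ne_zero)
  have hρ0 : ρ ≠ 0 := norm_ne_zero_iff.1 (by rw [hρ]; exact one_ne_zero)
  have e := hgs (n + 3)
  rw [add_assoc, hper, hgs n] at e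
  have h1 : (s (n + 3) : ℂ) * s n = 1 := by
    apply mul_right_cancel₀ (mul_ne_zero (pow_ne_zero 2 hρ0) hne)
    linear_combination -e
  have h2 : s (n + 3) * s n = 1 := by exact_mod_cast h1
  linear_combination s n * h2 - s (n + 3) * hs n

lemma sign_mul_im_nonneg (hg : ∀ n, ‖g n‖ = 1) (hper : ∀ n, g (n + 6) = ρ ^ 2 * g n)
    (hρ : ‖ρ‖ = 1) (hκ : 0 < ρ.im) (hs : ∀ n, s n ^ 2 = 1)
    (hgs : ∀ n, g (n + 3) = s n * ρ * g n)
    (h4 : ∀ n, (g (n + 4) / g n).re ≤ (g (n + 6) / g (n + 4)).re) (n : ℕ) :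
    0 ≤ s (n + 1) * (g (n + 1) / g n).im ∧ 0 ≤ s n * (g (n + 1) / g n).im := by
  have hne : ∀ n, g n ≠ 0 := fun n => norm_ne_zero_iff.1 (by rw [hg]; exact one_ne_zero)
  have hρ0 : ρ ≠ 0 := norm_ne_zero_iff.1 (by rw [hρ]; exact one_ne_zero)
  have hsc : ∀ n, (s n : ℂ) ^ 2 = 1 := fun n => by exact_mod_cast hs n
  have hs0 : ∀ n, (s n : ℂ) ≠ 0 := fun n h0 => by
    have := hsc n; rw [h0] at this; norm_num at this
  have first : ∀ n, 0 ≤ s (n + 1) * (g (n + 1) / g n).im := by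
    intro n
    have := hne n
    have := hne (n + 1)
    have := hs0 (n + 1)
    have hz1 : ‖g (n + 1) / g n‖ = 1 := by rw [norm_div, hg, hg, div_one]
    have e1 : g (n + 4) / g n = s (n + 1) * (ρ * (g (n + 1) / g n)) := by
      rw [hgs (n + 1)]; field_simp
    have e2 : g (n + 6) / g (n + 4) = s (n + 1) * (ρ * conj (g (n + 1) / g n)) := by
      rw [hper, hgs (n + 1), Complex.conj_eq_inv_of_norm_one hz1]
      field_simp
      rw [hsc]
    have h := h4 n
    rw [e1, e2, Complex.re_ofReal_mul, Complex.re_ofReal_mul, Complex.mul_re, Complex.mul_re,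
      Complex.conj_re, Complex.conj_im] at h
    have : 0 ≤ (s (n + 1) * (g (n + 1) / g n).im) * ρ.im := by linarith
    exact nonneg_of_mul_nonneg_left this hκ
  refine ⟨first n, ?_⟩
  -- Three steps later the neighbour ratio is multiplied by `s (n + 1) * s n` while the sign `s (n +
  -- 4)` equals `s (n + 1)`; what remains is the inequality with `s n`.
  have h := first (n + 3)
  have := hne n
  have e : g (n + 3 + 1) / g (n + 3) = ((s (n + 1) * s n : ℝ) : ℂ) * (g (n + 1) / g n) := by
    have := hs0 n
    rw [show n + 3 + 1 = n + 1 + 3 by ring, hgs, hgs]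
    push_cast
    field_simp
    rw [hsc, mul_one]
  have hp := sign_periodic hg hper hρ hs hgs (n + 1)
  rw [e, Complex.im_ofReal_mul, show n + 3 + 1 = n + 1 + 3 by ring, hp] at h
  have e' : s (n + 1) * (s (n + 1) * s n * (g (n + 1) / g n).im) =
      s (n + 1) ^ 2 * (s n * (g (n + 1) / g n).im) := by ring
  rwa [e', hs, one_mul] at h

/-- If `g (n + 1) = ± g n`, up to three consecutive positive relations become relations between `1`,
`w = g (n + 2) / g n` and `ρ`. Their imaginary parts, also after division by `ρ`, contradict the
sign inequalities. Non-vanishing is what lets those inequalities determine the signs `s n`. -/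
lemma im_div_ne_zero (hg : ∀ n, ‖g n‖ = 1) (hper : ∀ n, g (n + 6) = ρ ^ 2 * g n)
    (hρ : ‖ρ‖ = 1) (hκ : 0 < ρ.im) (hs : ∀ n, s n ^ 2 = 1)
    (hgs : ∀ n, g (n + 3) = s n * ρ * g n)
    (h4 : ∀ n, (g (n + 4) / g n).re ≤ (g (n + 6) / g (n + 4)).re)
    (hrel : ∀ n, ∃ a b c d : ℝ, 0 < a ∧ 0 < b ∧ 0 < c ∧ 0 < d ∧
        a * g n + b * g (n + 1) + c * g (n + 2) + d * g (n + 3) = 0) (n : ℕ) :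
    (g (n + 1) / g n).im ≠ 0 := by
  intro him
  have hne : ∀ n, g n ≠ 0 := fun n => norm_ne_zero_iff.1 (by rw [hg]; exact one_ne_zero)
  have hsgn := sign_mul_im_nonneg hg hper hρ hκ hs hgs h4
  set t := (g (n + 1) / g n).re with ht
  have hzt : g (n + 1) / g n = (t : ℂ) := Complex.ext rfl (by simpa using him)
  have ht2 : t ^ 2 = 1 := by
    have := Complex.re_sq_add_im_sq_of_norm_one (x := g (n + 1) / g n)
      (by rw [norm_div, hg, hg, div_one])
    rw [him] at this
    linarith
  have g1 : g (n + 1) = t * g n := by rw [← hzt, div_mul_cancel₀ _ (hne n)]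
  obtain ⟨w, hw⟩ : ∃ w, g (n + 2) = w * g n :=
    ⟨g (n + 2) / g n, by rw [div_mul_cancel₀ _ (hne n)]⟩
  have hw1 : ‖w‖ = 1 := by simpa [hg] using (congrArg norm hw).symm
  have g3 := hgs n
  have g4 : g (n + 4) = s (n + 1) * ρ * (t * g n) := by rw [← g1]; exact hgs (n + 1)
  have g5 : g (n + 5) = s (n + 2) * ρ * (w * g n) := by rw [← hw]; exact hgs (n + 2)
  have hρ2 := Complex.re_sq_add_im_sq_of_norm_one hρ
  obtain ⟨a, b, c, d, ha, hb, hc, hd, r⟩ := hrel n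
  obtain ⟨a', b', c', d', ha', hb', hc', hd', r'⟩ := hrel (n + 1)
  obtain ⟨a'', b'', c'', d'', ha'', hb'', hc'', hd'', r''⟩ := hrel (n + 2)
  rw [g1, hw, g3] at r
  change _ + _ * g (n + 2) + _ * g (n + 3) + _ * g (n + 4) = 0 at r'
  rw [g1, hw, g3, g4] at r'
  change _ + _ * g (n + 3) + _ * g (n + 4) + _ * g (n + 5) = 0 at r''
  rw [hw, g3, g4, g5] at r''
  have r0 : (a : ℂ) + b * t + c * w + d * s n * ρ = 0 := by
    apply mul_right_cancel₀ (hne n); linear_combination r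
  have r1 : (a' : ℂ) * t + b' * w + c' * s n * ρ + d' * s (n + 1) * t * ρ = 0 := by
    apply mul_right_cancel₀ (hne n); linear_combination r'
  have r2 : (a'' : ℂ) * w + b'' * s n * ρ + c'' * s (n + 1) * t * ρ + d'' * s (n + 2) * (ρ * w) =
      0 := by
    apply mul_right_cancel₀ (hne n); linear_combination r''
  have q0 := congrArg Complex.re r0
  have q0' := congrArg Complex.im r0
  have q1 := congrArg Complex.re r1
  have q1' := congrArg Complex.im r1
  have q2 := congrArg Complex.re r2
  have q2' := congrArg Complex.im r2
  simp at q0 q0' q1 q1' q2 q2'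
  have z1 : g (n + 1 + 1) / g (n + 1) = t * w := by
    have htc : (t : ℂ) ^ 2 = 1 := by exact_mod_cast ht2
    have ht0 : (t : ℂ) ≠ 0 := by
      intro h0; rw [h0] at htc; norm_num at htc
    have := hne n
    change g (n + 2) / _ = _
    rw [hw, g1]
    field_simp
    rw [htc, mul_one]
  have z2 : g (n + 2 + 1) / g (n + 2) = s n * (ρ * conj w) := by
    have := hne n
    have : w ≠ 0 := norm_ne_zero_iff.1 (by rw [hw1]; exact one_ne_zero)
    change g (n + 3) / _ = _
    rw [hw, g3, Complex.conj_eq_inv_of_norm_one hw1]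
    field_simp
  obtain ⟨p1, p1'⟩ := hsgn (n + 1)
  obtain ⟨p2, -⟩ := hsgn (n + 2)
  rw [z1, Complex.im_ofReal_mul] at p1 p1'
  change 0 ≤ s (n + 2) * _ at p1
  rw [z2, Complex.im_ofReal_mul, Complex.mul_im, Complex.conj_im, Complex.conj_re] at p2
  change 0 ≤ s (n + 3) * _ at p2
  rw [sign_periodic hg hper hρ hs hgs n] at p2
  have hsw : s n * w.im < 0 := by
    have e : c * (s n * w.im) = -(d * ρ.im) := by
      linear_combination s n * q0' - d * ρ.im * hs n
    have := mul_pos hd hκ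
    by_contra! hcon
    have := mul_nonneg hc.le hcon
    linarith
  have hw0 : w.im ≠ 0 := by
    rintro h0; rw [h0, mul_zero] at hsw; exact lt_irrefl _ hsw
  rcases sq_eq_one_iff.1 ht2 with h | h
  · rw [h] at q0 p1 p1'
    -- This is the imaginary part of `w / ρ`; the inequality `p2` says that it is not positive.
    have hx : 0 < w.im * ρ.re - w.re * ρ.im := by
      have e : c * (w.im * ρ.re - w.re * ρ.im) = (a + b) * ρ.im := by
        linear_combination ρ.re * q0' - ρ.im * q0
      have := mul_pos (add_pos ha hb) hκ
      by_contra! hcon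
      have := mul_nonpos_of_nonneg_of_nonpos hc.le hcon
      linarith
    have e : s n * (s n * (ρ.re * -w.im + ρ.im * w.re)) =
        -(w.im * ρ.re - w.re * ρ.im) := by
      linear_combination (ρ.re * -w.im + ρ.im * w.re) * hs n
    linarith
  · rw [h] at p1 p1' q1 q1' q2 q2'
    have hy0 : -1 * w.im ≠ 0 := by simpa using hw0
    have s1 : s (n + 1) = s n := eq_of_sq_eq_one_of_mul_pos (hs _) (hs _) hy0 p1' (by linarith)
    have s2 : s (n + 2) = s n := eq_of_sq_eq_one_of_mul_pos (hs _) (hs _) hy0 p1 (by linarith)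
    rw [s1] at q1 q1' q2 q2'
    rw [s2] at q2 q2'
    have hx : w.im * ρ.re - w.re * ρ.im < 0 := by
      have e : b' * (w.im * ρ.re - w.re * ρ.im) = -(a' * ρ.im) := by
        linear_combination ρ.re * q1' - ρ.im * q1
      have := mul_pos ha' hκ
      by_contra! hcon
      have := mul_nonneg hb'.le hcon
      linarith
    -- Imaginary part of the third relation divided by `ρ`: its two middle terms become real, and
    -- the two remaining ones are both negative.
    have e : a'' * (w.im * ρ.re - w.re * ρ.im) + d'' * (s n * w.im) = 0 := by
      linear_combination ρ.re * q2' - ρ.im * q2 - d'' * (s n * w.im) * hρ2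
    have := mul_neg_of_pos_of_neg ha'' hx
    have := mul_neg_of_pos_of_neg hd'' hsw
    linarith

lemma Complex.exists_angle {y : ℂ} (hy : ‖y‖ = 1) (him : 0 < y.im) :
    ∃ φ : ℝ, 0 < φ ∧ φ < Real.pi ∧ y = Complex.exp (φ * Complex.I) := by
  have h0 : y.arg ≠ 0 := fun h => by
    rw [Complex.arg_eq_zero_iff] at h; exact him.ne' h.2
  have h1 : y.arg ≠ Real.pi := fun h => by
    rw [Complex.arg_eq_pi_iff] at h; exact him.ne' h.2
  refine ⟨y.arg, (Complex.arg_nonneg_iff.2 him.le).lt_of_ne' h0,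
    (Complex.arg_le_pi y).lt_of_ne h1, ?_⟩
  have := Complex.norm_mul_exp_arg_mul_I y
  rw [hy] at this
  simpa using this.symm

/-- A sequence of unit vectors in the plane with these properties is determined by three angles. -/
lemma exists_angles (hg : ∀ n, ‖g n‖ = 1) (hω : ‖ω‖ = 1) (hω1 : ω ≠ 1)
    (hper : ∀ n, g (n + 6) = ω * g n)
    (h3 : ∀ n, (g (n + 3) / g n).re = (g (n + 6) / g (n + 3)).re)
    (h4 : ∀ n, (g (n + 4) / g n).re ≤ (g (n + 6) / g (n + 4)).re)
    (hrel : ∀ n, ∃ a b c d : ℝ, 0 < a ∧ 0 < b ∧ 0 < c ∧ 0 < d ∧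
        a * g n + b * g (n + 1) + c * g (n + 2) + d * g (n + 3) = 0) :
    ∃ φ : ℕ → ℝ, (∀ n, φ (n + 3) = φ n) ∧ (∀ n, 0 < φ n) ∧ φ 0 + φ 1 + φ 2 < Real.pi ∧
      (∀ n, (g (n + 1) / g n).re = -Real.cos (φ n)) ∧
      (∀ n, (g (n + 2) / g n).re = Real.cos (φ n + φ (n + 1))) ∧
      (∀ n, (g (n + 3) / g n).re = -Real.cos (φ n + φ (n + 1) + φ (n + 2))) := by
  have hne : ∀ n, g n ≠ 0 := fun n => norm_ne_zero_iff.1 (by rw [hg]; exact one_ne_zero)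
  -- Of the two square roots of `ω`, one has positive imaginary part, because a real root would give
  -- `ω = 1`.
  obtain ⟨ρ, hρω, hρ, hκ⟩ : ∃ ρ : ℂ, ρ ^ 2 = ω ∧ ‖ρ‖ = 1 ∧ 0 < ρ.im := by
    obtain ⟨v, hv⟩ := IsAlgClosed.exists_pow_nat_eq ω zero_lt_two
    have hv1 : ‖v‖ = 1 := by
      have : ‖v‖ ^ 2 = 1 := by rw [← norm_pow, hv, hω]
      nlinarith [norm_nonneg v]
    rcases lt_trichotomy v.im 0 with h | h | h
    · exact ⟨-v, by rw [neg_sq, hv], by rw [norm_neg, hv1], by simpa using h⟩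
    · exfalso
      apply hω1
      have hvr : v = (v.re : ℂ) := Complex.ext rfl (by simpa using h)
      have := Complex.re_sq_add_im_sq_of_norm_one hv1
      rw [h] at this
      have : v.re ^ 2 = 1 := by linarith
      rw [← hv, hvr]
      exact_mod_cast this
    · exact ⟨v, hv, hv1, h⟩
  rw [← hρω] at hper
  choose s hs hgs using exists_sign_of_rotation hg hper hρ hκ h3
  have him := im_div_ne_zero hg hper hρ hκ hs hgs h4 hrel
  have hsgn := sign_mul_im_nonneg hg hper hρ hκ hs hgs h4
  have hsc : ∀ n, s n = s 0 := by
    intro n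
    induction n with
    | zero => rfl
    | succ n ih =>
      rw [← ih]
      exact eq_of_sq_eq_one_of_mul_pos (hs _) (hs _) (him n) (hsgn n).1 (hsgn n).2
  set z : ℕ → ℂ := fun n => g (n + 1) / g n with hz
  have hz1 : ∀ n, ‖z n‖ = 1 := fun n => by rw [hz]; simp [hg]
  have hz3 : ∀ n, z (n + 3) = z n := by
    intro n
    have h0 : (s 0 : ℂ) ≠ 0 := by
      have := hs 0
      intro h; rw [Complex.ofReal_eq_zero.1 h] at this; norm_num at this
    have hρ0 : ρ ≠ 0 := norm_ne_zero_iff.1 (by rw [hρ]; exact one_ne_zero)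
    have := hne n
    simp only [hz]
    rw [show n + 3 + 1 = n + 1 + 3 by ring, hgs, hgs, hsc n, hsc (n + 1)]
    field_simp
  have e2 : ∀ n, g (n + 2) / g n = z n * z (n + 1) := by
    intro n
    have := hne n
    have := hne (n + 1)
    simp only [hz]
    field_simp
  have e3 : ∀ n, g (n + 3) / g n = z n * z (n + 1) * z (n + 2) := by
    intro n
    have := hne n
    have := hne (n + 1)
    have := hne (n + 2)
    simp only [hz]
    field_simp
  -- Only real parts matter for the conclusion, so conjugation may be applied to fix the orientation
  -- according to the common sign `s 0`.
  obtain ⟨f, hfre, hfn, hfr, hfim, hfρ⟩ : ∃ f : ℂ →+* ℂ, (∀ x, (f x).re = x.re) ∧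
      (∀ x, ‖f x‖ = ‖x‖) ∧ (∀ r : ℝ, f r = r) ∧ (∀ n, 0 < (-f (z n)).im) ∧
      0 < (-f (g 3 / g 0)).im := by
    have e : g 3 / g 0 = s 0 * ρ := by
      have := hgs 0
      rw [zero_add] at this
      rw [this, mul_div_cancel_right₀ _ (hne 0)]
    have hz' : ∀ n, 0 < s 0 * (z n).im := by
      intro n
      refine lt_of_le_of_ne (by rw [← hsc n]; exact (hsgn n).2) (mul_ne_zero ?_ (him n)).symm
      have := hs 0
      intro h; rw [h] at this; norm_num at this
    rcases sq_eq_one_iff.1 (hs 0) with h | h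
    · refine ⟨starRingEnd ℂ, fun x => rfl, fun x => by simp, fun r => by simp, fun n => ?_, ?_⟩
      · have := hz' n
        rw [h] at this
        simpa using this
      · rw [e, h]; simpa using hκ
    · refine ⟨RingHom.id ℂ, fun x => rfl, fun x => rfl, fun r => rfl, fun n => ?_, ?_⟩
      · have := hz' n
        rw [h] at this
        simpa using this
      · rw [e, h]; simpa using hκ
  choose ψ hψ0 hψπ hψ using fun n => Complex.exists_angle (y := -f (z n))
    (by rw [norm_neg, hfn, hz1]) (hfim n)
  have hinj : ∀ n, ψ (n + 3) = ψ n := by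
    intro n
    have := hψ (n + 3)
    rw [hz3, hψ n] at this
    have h := congrArg Complex.re this
    rw [Complex.exp_ofReal_mul_I_re, Complex.exp_ofReal_mul_I_re] at h
    exact (Real.injOn_cos ⟨(hψ0 _).le, (hψπ _).le⟩ ⟨(hψ0 _).le, (hψπ _).le⟩ h).symm
  have f1 : ∀ n, f (z n) = -Complex.exp (ψ n * Complex.I) := fun n => by rw [← hψ, neg_neg]
  have f2 : ∀ n, f (g (n + 2) / g n) = Complex.exp ((ψ n + ψ (n + 1) : ℝ) * Complex.I) := by
    intro n
    rw [e2, map_mul, f1, f1, neg_mul_neg, ← Complex.exp_add]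
    push_cast; ring_nf
  have f3 : ∀ n, f (g (n + 3) / g n) =
      -Complex.exp ((ψ n + ψ (n + 1) + ψ (n + 2) : ℝ) * Complex.I) := by
    intro n
    rw [e3, map_mul, map_mul, f1, f1, f1, neg_mul_neg, mul_neg, ← Complex.exp_add,
      ← Complex.exp_add]
    push_cast; ring_nf
  refine ⟨ψ, hinj, hψ0, ?_, fun n => ?_, fun n => ?_, fun n => ?_⟩
  · obtain ⟨a, b, c, d, ha, hb, hc, hd, r⟩ := hrel 0
    have r' : (a : ℂ) + b * z 0 + c * (g (0 + 2) / g 0) + d * (g (0 + 3) / g 0) = 0 := by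
      have := hne 0
      simp only [hz]
      field_simp
      linear_combination r
    have r'' := congrArg f r'
    rw [map_add, map_add, map_add, map_mul, map_mul, map_mul, hfr, hfr, hfr, hfr, f1, f2, f3,
      map_zero] at r''
    rw [show g 3 = g (0 + 3) from rfl, f3, neg_neg, Complex.exp_ofReal_mul_I_im] at hfρ
    have q := congrArg Complex.im r''
    rw [Complex.add_im, Complex.add_im, Complex.add_im, Complex.im_ofReal_mul,
      Complex.im_ofReal_mul, Complex.im_ofReal_mul, Complex.neg_im, Complex.neg_im,
      Complex.exp_ofReal_mul_I_im, Complex.exp_ofReal_mul_I_im, Complex.exp_ofReal_mul_I_im,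
      Complex.ofReal_im, Complex.zero_im] at q
    simp only [zero_add] at q hfρ
    have hsin0 := Real.sin_pos_of_pos_of_lt_pi (hψ0 0) (hψπ 0)
    -- In the imaginary part of the relation at `0` the first and third sines enter with negative
    -- sign, so the middle one must be positive. This bounds the first two angles by π, and then the
    -- sum of all three is below 2π with positive sine.
    have hsin : 0 < Real.sin (ψ 0 + ψ 1) := by
      have h1 := mul_pos hb hsin0
      have h2 := mul_pos hd hfρ
      by_contra! hcon
      have := mul_nonpos_of_nonneg_of_nonpos hc.le hcon
      linarith
    have lt_pi : ∀ x : ℝ, x < 2 * Real.pi → 0 < Real.sin x → x < Real.pi := by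
      intro x hx hsx
      by_contra! hcon
      have h1 := Real.sin_nonneg_of_nonneg_of_le_pi (x := x - Real.pi) (by linarith) (by linarith)
      rw [Real.sin_sub_pi] at h1
      linarith
    have h01 := lt_pi _ (by linarith [hψπ 0, hψπ 1]) hsin
    exact lt_pi _ (by linarith [hψπ 2]) hfρ
  · rw [← hfre, show f (g (n + 1) / g n) = _ from f1 n, Complex.neg_re,
      Complex.exp_ofReal_mul_I_re]
  · rw [← hfre, f2, Complex.exp_ofReal_mul_I_re]
  · rw [← hfre, f3, Complex.neg_re, Complex.exp_ofReal_mul_I_re]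

end Angles

namespace CyclicZeros

variable {A : Matrix (Fin 6) (Fin 6) ℝ} {u : Fin 6 → Fin 6 → ℝ}

lemma exists_eq_trigMatrix (h : CyclicZeros A u)
    (hpsd : ∀ x : Fin 6 → ℝ, x 3 = 0 → x 4 = 0 → x 5 = 0 → 0 ≤ x ⬝ᵥ (A *ᵥ x))
    (hexc : IsExceptional A) (hext : IsExtremalCopositive A) (hdiag : ∀ i, A i i = 1) :
    ∃ a b c : ℝ, 0 < a ∧ 0 < b ∧ 0 < c ∧ a + b + c < Real.pi ∧ A = trigMatrix a b c := by
  obtain ⟨g, ω, hg, hω, hω1, hper, h1, h2, h3, hrel, h4⟩ :=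
    h.exists_unit_sequence hpsd hexc hext hdiag
  have h3' : ∀ n, (g (n + 3) / g n).re = (g (n + 6) / g (n + 3)).re := by
    intro n
    have := h3 (n + 3)
    rw [add_assoc, cyc_add_six] at this
    rw [h3, this, h.symm.apply]
  obtain ⟨φ, hφ3, hφ0, hφπ, k1, k2, k3⟩ := exists_angles hg hω hω1 hper h3' h4 hrel
  simp only [h1] at k1
  simp only [h2] at k2
  simp only [h3] at k3
  have p3 := hφ3 0
  have p4 := hφ3 1
  have p5 := hφ3 2
  have p6 := hφ3 3
  simp only [Nat.reduceAdd] at p3 p4 p5 p6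
  have a0 : A 0 1 = -Real.cos (φ 0) := k1 0
  have a1 : A 1 2 = -Real.cos (φ 1) := k1 1
  have a2 : A 2 3 = -Real.cos (φ 2) := k1 2
  have a3 : A 3 4 = -Real.cos (φ 3) := k1 3
  have a4 : A 4 5 = -Real.cos (φ 4) := k1 4
  have a5 : A 5 0 = -Real.cos (φ 5) := k1 5
  have b0 : A 0 2 = Real.cos (φ 0 + φ 1) := k2 0
  have b1 : A 1 3 = Real.cos (φ 1 + φ 2) := k2 1
  have b2 : A 2 4 = Real.cos (φ 2 + φ 3) := k2 2
  have b3 : A 3 5 = Real.cos (φ 3 + φ 4) := k2 3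
  have b4 : A 4 0 = Real.cos (φ 4 + φ 5) := k2 4
  have b5 : A 5 1 = Real.cos (φ 5 + φ 6) := k2 5
  have c0 : A 0 3 = -Real.cos (φ 0 + φ 1 + φ 2) := k3 0
  have c1 : A 1 4 = -Real.cos (φ 1 + φ 2 + φ 3) := k3 1
  have c2 : A 2 5 = -Real.cos (φ 2 + φ 3 + φ 4) := k3 2
  have s := h.symm.apply
  rw [p6] at b5
  rw [p3] at a3 b2 b3 b5 c1 c2
  rw [p4] at a4 b3 b4 c2
  rw [p5] at a5 b4 b5
  refine ⟨φ 0, φ 1, φ 2, hφ0 0, hφ0 1, hφ0 2, hφπ, ?_⟩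
  rw [show φ 1 + φ 2 + φ 0 = φ 0 + φ 1 + φ 2 by ring] at c1
  rw [show φ 2 + φ 0 + φ 1 = φ 0 + φ 1 + φ 2 by ring] at c2
  rw [add_comm (φ 2)] at b2 b5
  ext i j
  fin_cases i <;> fin_cases j <;> simp [trigMatrix, hdiag]
  all_goals first
    | assumption
    | (rw [s]; assumption)

end CyclicZeros

/-! ### Verification of the three-index zeros of the trigonometric matrix -/

/-- The properties at the index `j` of a form `T` and a system of zeros `v` of it, each supported on
three cyclically consecutive indices. -/
structure IsCyclicTriple (T : Matrix (Fin 6) (Fin 6) ℝ) (v : Fin 6 → Fin 6 → ℝ) (j : Fin 6) :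
    Prop where
  pos0 : 0 < v j j
  pos1 : 0 < v j (j + 1)
  pos2 : 0 < v j (j + 2)
  zero3 : v j (j + 3) = 0
  zero4 : v j (j + 4) = 0
  zero5 : v j (j + 5) = 0
  ker0 : (T *ᵥ v j) j = 0
  ker1 : (T *ᵥ v j) (j + 1) = 0
  ker2 : (T *ᵥ v j) (j + 2) = 0
  ker3 : (T *ᵥ v j) (j + 3) = 0
  pos4 : 0 < (T *ᵥ v j) (j + 4)
  ker5 : (T *ᵥ v j) (j + 5) = 0
  diag : T j j = 1
  definite : ∀ z : Fin 6 → ℝ, (∀ i, i ≠ j → i ≠ j + 1 → z i = 0) → z ⬝ᵥ (T *ᵥ z) ≤ 0 → z = 0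
  row : ∀ x : Fin 6 → ℝ, x j = 0 → (∀ k, k ≠ j + 2 → x ⬝ᵥ v k = 0) → x = 0

lemma sum_add_one (f : Fin 6 → ℝ) : ∑ i, f (i + 1) = ∑ i, f i :=
  Equiv.sum_comp (Equiv.addRight 1) f

lemma IsCyclicTriple.of_shift {T : Matrix (Fin 6) (Fin 6) ℝ} {v : Fin 6 → Fin 6 → ℝ} {j : Fin 6}
    (h : IsCyclicTriple (T.submatrix (· + 1) (· + 1)) (fun k i => v (k + 1) (i + 1)) j) :
    IsCyclicTriple T v (j + 1) := by
  have hmul : ∀ (w : Fin 6 → ℝ) i,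
      (T.submatrix (· + 1) (· + 1) *ᵥ fun i => w (i + 1)) i = (T *ᵥ w) (i + 1) := fun w i =>
    sum_add_one fun k => T (i + 1) k * w k
  have hdot : ∀ x y : Fin 6 → ℝ, (fun i => x (i + 1)) ⬝ᵥ (fun i => y (i + 1)) = x ⬝ᵥ y :=
    fun x y => sum_add_one fun k => x k * y k
  have hext : ∀ x : Fin 6 → ℝ, (fun i => x (i + 1)) = 0 → x = 0 := by
    intro x hx
    ext i
    have := congrFun hx (i - 1)
    simpa using this
  have e : ∀ k : Fin 6, j + 1 + k = j + k + 1 := fun k => add_right_comm j 1 k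
  have k0 := h.ker0
  have k1 := h.ker1
  have k2 := h.ker2
  have k3 := h.ker3
  have k4 := h.pos4
  have k5 := h.ker5
  rw [hmul] at k0 k1 k2 k3 k4 k5
  refine
    { pos0 := h.pos0
      pos1 := by rw [e]; exact h.pos1
      pos2 := by rw [e]; exact h.pos2
      zero3 := by rw [e]; exact h.zero3
      zero4 := by rw [e]; exact h.zero4
      zero5 := by rw [e]; exact h.zero5
      ker0 := k0
      ker1 := by rw [e]; exact k1
      ker2 := by rw [e]; exact k2
      ker3 := by rw [e]; exact k3
      pos4 := by rw [e]; exact k4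
      ker5 := by rw [e]; exact k5
      diag := h.diag
      definite := fun z hz hq => hext z (h.definite _ (fun i h1 h2 => ?_) ?_)
      row := fun x hx hk => hext x (h.row _ hx fun k hkj => ?_) }
  · exact hz _ (by simpa using h1) (by simpa [e] using h2)
  · rw [funext (hmul z), hdot]; exact hq
  · rw [hdot]; exact hk _ (by rw [e]; simpa using hkj)

section TrigMatrix

lemma trigMatrix_submatrix (a b c : ℝ) :
    (trigMatrix a b c).submatrix (· + 1) (· + 1) = trigMatrix b c a := by
  have h1 : b + c + a = a + b + c := by ring
  have h2 : c + a = a + c := by ring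
  have h3 : b + a = a + b := by ring
  ext i j
  fin_cases i <;> fin_cases j <;> simp [trigMatrix, h1, h2, h3]

lemma trigZeroMatrix_shift (a b c : ℝ) (i j : Fin 6) :
    trigZeroMatrix a b c (i + 1) (j + 1) = trigZeroMatrix b c a i j := by
  have h2 : c + a = a + c := by ring
  have h3 : b + a = a + b := by ring
  fin_cases i <;> fin_cases j <;> simp [trigZeroMatrix, h2, h3]

variable {a b c : ℝ}

lemma isCyclicTriple_zero (ha : 0 < a) (hb : 0 < b) (hc : 0 < c) (h : a + b + c < Real.pi) :
    IsCyclicTriple (trigMatrix a b c) (trigZeroMatrix a b c).col 0 := by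
  have sin_pos : ∀ x, 0 < x → x < Real.pi → 0 < Real.sin x :=
    fun x => Real.sin_pos_of_pos_of_lt_pi
  have sa := sin_pos a ha (by linarith)
  have sb := sin_pos b hb (by linarith)
  have sc := sin_pos c hc (by linarith)
  have sab := sin_pos (a + b) (by linarith) (by linarith)
  have ss := sin_pos (a + b + c) (by linarith) h
  have ea := Real.sin_sq_add_cos_sq a
  have eb := Real.sin_sq_add_cos_sq b
  have ec := Real.sin_sq_add_cos_sq c
  have hm : ∀ i, (trigMatrix a b c *ᵥ (trigZeroMatrix a b c).col 0) i =
      trigMatrix a b c i 0 * Real.sin b + trigMatrix a b c i 1 * Real.sin (a + b) +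
        trigMatrix a b c i 2 * Real.sin a := by
    intro i
    simp [mulVec, dotProduct, Fin.sum_univ_six, trigZeroMatrix]
  refine
    { pos0 := by simpa [trigZeroMatrix] using sb
      pos1 := by simpa [trigZeroMatrix] using sab
      pos2 := by simpa [trigZeroMatrix] using sa
      zero3 := by simp [trigZeroMatrix]
      zero4 := by simp [trigZeroMatrix]
      zero5 := by simp [trigZeroMatrix]
      ker0 := ?_
      ker1 := ?_
      ker2 := ?_
      ker3 := ?_
      pos4 := ?_
      ker5 := ?_
      diag := by simp [trigMatrix]
      definite := fun z hz hq => ?_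
      row := fun x hx hk => ?_ }
  · rw [hm]
    simp [trigMatrix]
    rw [Real.cos_add, Real.sin_add]
    linear_combination -Real.sin b * ea
  · rw [hm]
    simp [trigMatrix]
    rw [Real.sin_add]
    ring
  · rw [hm]
    simp [trigMatrix]
    rw [Real.cos_add, Real.sin_add]
    linear_combination -Real.sin a * eb
  · rw [hm]
    simp [trigMatrix]
    simp only [Real.cos_add, Real.sin_add]
    grind
  · rw [hm]
    have e : trigMatrix a b c (0 + 4) 0 * Real.sin b + trigMatrix a b c (0 + 4) 1 *
        Real.sin (a + b) + trigMatrix a b c (0 + 4) 2 * Real.sin a =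
        2 * (Real.sin a * Real.sin b * Real.sin (a + b + c)) := by
      simp [trigMatrix]
      simp only [Real.cos_add, Real.sin_add]
      grind
    rw [e]
    positivity
  · rw [hm]
    simp [trigMatrix]
    simp only [Real.cos_add, Real.sin_add]
    grind
  · have z2 := hz 2 (by decide) (by decide)
    have z3 := hz 3 (by decide) (by decide)
    have z4 := hz 4 (by decide) (by decide)
    have z5 := hz 5 (by decide) (by decide)
    simp [mulVec, dotProduct, Fin.sum_univ_six, z2, z3, z4, z5, trigMatrix] at hq
    have hsum : (z 0 - Real.cos a * z 1) ^ 2 + (Real.sin a * z 1) ^ 2 ≤ 0 := by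
      have e : (z 0 - Real.cos a * z 1) ^ 2 + (Real.sin a * z 1) ^ 2 =
          z 0 * (z 0 + -(Real.cos a * z 1)) + z 1 * (-(Real.cos a * z 0) + z 1) := by
        linear_combination z 1 ^ 2 * ea
      linarith
    have h1 : (Real.sin a * z 1) ^ 2 = 0 := by
      nlinarith [sq_nonneg (z 0 - Real.cos a * z 1), sq_nonneg (Real.sin a * z 1)]
    have z1 : z 1 = 0 := (mul_eq_zero.1 (pow_eq_zero_iff two_ne_zero |>.1 h1)).resolve_left sa.ne'
    have z0 : z 0 = 0 := by
      rw [z1] at hsum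
      nlinarith
    ext i
    fin_cases i <;> assumption
  · have k0 := hk 0 (by decide)
    have k1 := hk 1 (by decide)
    have k3 := hk 3 (by decide)
    have k4 := hk 4 (by decide)
    have k5 := hk 5 (by decide)
    simp [dotProduct, Fin.sum_univ_six, trigZeroMatrix, hx] at k0 k1 k3 k4 k5
    -- Ptolemy's identity. It yields two expressions of opposite sign for the same multiple of `x
    -- 3`, which forces `x 1 = 0`; the other entries follow.
    have id : Real.sin (a + b) * Real.sin (b + c) =
        Real.sin a * Real.sin c + Real.sin b * Real.sin (a + b + c) := by
      simp only [Real.cos_add, Real.sin_add]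
      grind
    have x4 : Real.sin a * x 4 = Real.sin (b + c) * x 1 := by
      apply mul_left_cancel₀ sc.ne'
      linear_combination Real.sin a * k4 - Real.sin (b + c) * k5
    have e1 : Real.sin a * Real.sin b * x 3 = Real.sin b * Real.sin (a + b + c) * x 1 := by
      linear_combination Real.sin a * k1 - Real.sin (b + c) * k0 + x 1 * id
    have e2 : Real.sin a * Real.sin b * x 3 = -(Real.sin b * Real.sin (a + b + c) * x 1) := by
      linear_combination Real.sin a * k3 - Real.sin (a + b) * x4 - Real.sin a * k5 - x 1 * id
    have x1 : x 1 = 0 := by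
      have : Real.sin b * Real.sin (a + b + c) * x 1 = 0 := by linarith
      exact (mul_eq_zero.1 this).resolve_left (mul_pos sb ss).ne'
    rw [x1] at k0 k5 x4 e1
    have x2 : x 2 = 0 := by
      have : Real.sin a * x 2 = 0 := by linarith
      exact (mul_eq_zero.1 this).resolve_left sa.ne'
    have x3 : x 3 = 0 := by
      have : Real.sin a * Real.sin b * x 3 = 0 := by linarith
      exact (mul_eq_zero.1 this).resolve_left (mul_pos sa sb).ne'
    have x4' : x 4 = 0 := by
      have : Real.sin a * x 4 = 0 := by linarith
      exact (mul_eq_zero.1 this).resolve_left sa.ne'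
    have x5 : x 5 = 0 := by
      have : Real.sin a * x 5 = 0 := by linarith
      exact (mul_eq_zero.1 this).resolve_left sa.ne'
    ext i
    fin_cases i <;> assumption

/-- Shifting the indices by one permutes the angles cyclically, so the computation at index `0` for
all angles covers every index. -/
lemma isCyclicTriple_trigMatrix (ha : 0 < a) (hb : 0 < b) (hc : 0 < c)
    (h : a + b + c < Real.pi) (j : Fin 6) :
    IsCyclicTriple (trigMatrix a b c) (trigZeroMatrix a b c).col j := by
  have step : ∀ j : Fin 6,
      (∀ a b c : ℝ, 0 < a → 0 < b → 0 < c → a + b + c < Real.pi →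
        IsCyclicTriple (trigMatrix a b c) (trigZeroMatrix a b c).col j) →
      ∀ a b c : ℝ, 0 < a → 0 < b → 0 < c → a + b + c < Real.pi →
        IsCyclicTriple (trigMatrix a b c) (trigZeroMatrix a b c).col (j + 1) := by
    intro j hj a b c ha hb hc h
    apply IsCyclicTriple.of_shift
    have := hj b c a hb hc ha (by linarith)
    rw [trigMatrix_submatrix]
    convert this using 1
    ext k i
    exact trigZeroMatrix_shift a b c i k
  have s0 := fun a b c (ha : (0 : ℝ) < a) (hb : (0 : ℝ) < b) (hc : (0 : ℝ) < c) h =>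
    isCyclicTriple_zero (a := a) (b := b) (c := c) ha hb hc h
  have s1 := step 0 s0
  have s2 := step 1 s1
  have s3 := step 2 s2
  have s4 := step 3 s3
  have s5 := step 4 s4
  fin_cases j
  · exact s0 a b c ha hb hc h
  · exact s1 a b c ha hb hc h
  · exact s2 a b c ha hb hc h
  · exact s3 a b c ha hb hc h
  · exact s4 a b c ha hb hc h
  · exact s5 a b c ha hb hc h

lemma trigMatrix_isSymm (a b c : ℝ) : (trigMatrix a b c).IsSymm := by
  ext i j
  fin_cases i <;> fin_cases j <;> rfl

end TrigMatrix

/-! ### Copositivity, extremality and minimal zeros in the converse direction -/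

namespace IsCyclicTriple

variable {T : Matrix (Fin 6) (Fin 6) ℝ} {v : Fin 6 → Fin 6 → ℝ}

lemma dotProduct_mulVec {j : Fin 6} (h : IsCyclicTriple T v j) (x : Fin 6 → ℝ) :
    x ⬝ᵥ (T *ᵥ v j) = x (j + 4) * (T *ᵥ v j) (j + 4) := by
  rw [dotProduct, sum_fin_six_shift j, h.ker0, h.ker1, h.ker2, h.ker3, h.ker5]
  ring

lemma quadratic_self {j : Fin 6} (h : IsCyclicTriple T v j) : v j ⬝ᵥ (T *ᵥ v j) = 0 := by
  rw [h.dotProduct_mulVec, h.zero4, zero_mul]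

lemma nonneg {j : Fin 6} (h : IsCyclicTriple T v j) : 0 ≤ v j :=
  fun i => forall_fin_six_shift j (p := fun i => 0 ≤ v j i) h.pos0.le h.pos1.le h.pos2.le
    h.zero3.ge h.zero4.ge h.zero5.ge i

lemma ne_zero {j : Fin 6} (h : IsCyclicTriple T v j) : v j ≠ 0 := fun h0 => by
  have := h.pos0
  rw [h0] at this
  exact lt_irrefl _ this

lemma isCopositiveZero {j : Fin 6} (h : IsCyclicTriple T v j) : IsCopositiveZero T (v j) :=
  ⟨h.nonneg, h.ne_zero, h.quadratic_self⟩

lemma mem_posSupport_iff {j : Fin 6} (h : IsCyclicTriple T v j) (i : Fin 6) :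
    i ∈ posSupport (v j) ↔ i = j ∨ i = j + 1 ∨ i = j + 2 := by
  refine forall_fin_six_shift j (p := fun i => i ∈ posSupport (v j) ↔
    i = j ∨ i = j + 1 ∨ i = j + 2) ?_ ?_ ?_ ?_ ?_ ?_ i
  · simpa [posSupport] using h.pos0
  · simpa [posSupport] using h.pos1
  · simpa [posSupport] using h.pos2
  · simp [posSupport, h.zero3]
  · simp [posSupport, h.zero4]
  · simp [posSupport, h.zero5]

/-- The vectors `v`, written with the indices of the two following windows. -/
lemma succ_facts (h : ∀ j, IsCyclicTriple T v j) (j : Fin 6) :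
    (0 < v (j + 1) (j + 1) ∧ 0 < v (j + 1) (j + 2) ∧ 0 < v (j + 1) (j + 3) ∧
      v (j + 1) (j + 4) = 0 ∧ v (j + 1) (j + 5) = 0 ∧ v (j + 1) j = 0) ∧
    ((T *ᵥ v (j + 1)) (j + 1) = 0 ∧ (T *ᵥ v (j + 1)) (j + 2) = 0 ∧
      (T *ᵥ v (j + 1)) (j + 3) = 0 ∧ (T *ᵥ v (j + 1)) (j + 4) = 0 ∧
      0 < (T *ᵥ v (j + 1)) (j + 5) ∧ (T *ᵥ v (j + 1)) j = 0) := by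
  have e1 : j + 1 + 1 = j + 2 := fin_six_add_add j 1 1 2 rfl
  have e2 : j + 1 + 2 = j + 3 := fin_six_add_add j 1 2 3 rfl
  have e3 : j + 1 + 3 = j + 4 := fin_six_add_add j 1 3 4 rfl
  have e4 : j + 1 + 4 = j + 5 := fin_six_add_add j 1 4 5 rfl
  have e5 : j + 1 + 5 = j := by rw [fin_six_add_add j 1 5 0 rfl, add_zero]
  have hj := h (j + 1)
  refine ⟨⟨hj.pos0, e1 ▸ hj.pos1, e2 ▸ hj.pos2, e3 ▸ hj.zero3, e4 ▸ hj.zero4, ?_⟩,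
    hj.ker0, e1 ▸ hj.ker1, e2 ▸ hj.ker2, e3 ▸ hj.ker3, e4 ▸ hj.pos4, ?_⟩
  · have := hj.zero5; rwa [e5] at this
  · have := hj.ker5; rwa [e5] at this

/-- Neighbouring zeros `v j` and `v (j + 1)` annihilate each other under the form, so their sum is a
zero on four indices, and the copositivity criterion applies to it. -/
lemma cyclicZeros (hT : T.IsSymm) (h : ∀ j, IsCyclicTriple T v j) :
    CyclicZeros T (fun j => v j + v (j + 1)) := by
  have hs := succ_facts h
  exact
    { symm := hT
      pos0 := fun j => add_pos_of_pos_of_nonneg (h j).pos0 ((h (j + 1)).nonneg _)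
      pos1 := fun j => add_pos_of_pos_of_nonneg (h j).pos1 ((h (j + 1)).nonneg _)
      pos2 := fun j => add_pos_of_pos_of_nonneg (h j).pos2 ((h (j + 1)).nonneg _)
      pos3 := fun j => add_pos_of_nonneg_of_pos ((h j).nonneg _) (hs j).1.2.2.1
      zero4 := fun j => by rw [Pi.add_apply, (h j).zero4, (hs j).1.2.2.2.1, add_zero]
      zero5 := fun j => by rw [Pi.add_apply, (h j).zero5, (hs j).1.2.2.2.2.1, add_zero]
      ker0 := fun j => by rw [mulVec_add, Pi.add_apply, (h j).ker0, (hs j).2.2.2.2.2.2, add_zero]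
      ker1 := fun j => by rw [mulVec_add, Pi.add_apply, (h j).ker1, (hs j).2.1, add_zero]
      ker2 := fun j => by rw [mulVec_add, Pi.add_apply, (h j).ker2, (hs j).2.2.1, add_zero]
      ker3 := fun j => by rw [mulVec_add, Pi.add_apply, (h j).ker3, (hs j).2.2.2.1, add_zero]
      nonneg4 := fun j => by
        rw [mulVec_add, Pi.add_apply, (hs j).2.2.2.2.1, add_zero]
        exact (h j).pos4.le
      nonneg5 := fun j => by
        rw [mulVec_add, Pi.add_apply, (h j).ker5, zero_add]
        exact (hs j).2.2.2.2.2.1.le }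

lemma eq_zero_of_pair {j : Fin 6} (h : IsCyclicTriple T v j) {z : Fin 6 → ℝ} (h2 : z (j + 2) = 0)
    (h3 : z (j + 3) = 0) (h4 : z (j + 4) = 0) (h5 : z (j + 5) = 0) (hq : z ⬝ᵥ (T *ᵥ z) ≤ 0) :
    z = 0 := by
  refine h.definite z (fun i => ?_) hq
  exact forall_fin_six_shift j (p := fun i => i ≠ j → i ≠ j + 1 → z i = 0)
    (fun h => absurd rfl h) (fun _ h => absurd rfl h) (fun _ _ => h2) (fun _ _ => h3)
    (fun _ _ => h4) (fun _ _ => h5) i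

lemma quadratic_nonneg_of_triple (hT : T.IsSymm) {j : Fin 6} (h : IsCyclicTriple T v j)
    {x : Fin 6 → ℝ} (h3 : x (j + 3) = 0) (h4 : x (j + 4) = 0) (h5 : x (j + 5) = 0) :
    0 ≤ x ⬝ᵥ (T *ᵥ x) := by
  by_contra! hneg
  set c := x (j + 2) / v j (j + 2) with hc
  have hx : x = (x - c • v j) + c • v j := by abel
  have hq := hT.quadratic_add_smul (x - c • v j) (v j) c
  rw [← hx, h.quadratic_self, h.dotProduct_mulVec] at hq
  have z4 : (x - c • v j) (j + 4) = 0 := by simp [h4, h.zero4]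
  rw [z4] at hq
  have hz := h.eq_zero_of_pair (z := x - c • v j) (by simp [hc, h.pos2.ne'])
    (by simp [h3, h.zero3]) z4 (by simp [h5, h.zero5]) (by linarith)
  rw [hz] at hq
  simp only [mulVec_zero, dotProduct_zero] at hq
  linarith

lemma copositive (hT : T.IsSymm) (h : ∀ j, IsCyclicTriple T v j) : Copositive T :=
  (cyclicZeros hT h).copositive fun _ h3 h4 h5 => (h 0).quadratic_nonneg_of_triple hT h3 h4 h5

/-- By extremality, in a decomposition `P + N` either `T = N` or `T` is a positive multiple of `P`.
An entrywise nonnegative `T` with unit diagonal cannot annihilate `v 0` in row `0`. A semi-definite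
`T` would annihilate `v 0` in every row, against `pos4`. -/
lemma isExceptional (hT : T.IsSymm) (h : ∀ j, IsCyclicTriple T v j)
    (hext : IsExtremalCopositive T) : IsExceptional T := by
  refine ⟨copositive hT h, ?_⟩
  rintro ⟨P, N, hP, hN, hN0, hPN⟩
  have hNc : Copositive N := by
    refine ⟨hN, fun x hx => Finset.sum_nonneg fun i _ => mul_nonneg (hx i) ?_⟩
    rw [mulVec, dotProduct]
    exact Finset.sum_nonneg fun k _ => mul_nonneg (hN0 i k) (hx k)
  obtain ⟨⟨p, hp, hpT⟩, -⟩ := hext.2.2 P N hP.copositive hNc hPN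
  have h0 := h 0
  rcases hp.eq_or_lt with rfl | hp
  · have hTN : T = N := by rw [hPN, hpT, zero_smul, zero_add]
    have hker := h0.ker0
    have hle : T 0 0 * v 0 0 ≤ (T *ᵥ v 0) 0 := Finset.single_le_sum (f := fun k => T 0 k * v 0 k)
      (fun k _ => mul_nonneg (by rw [hTN]; exact hN0 0 k) (h0.nonneg k)) (Finset.mem_univ 0)
    rw [hker, h0.diag, one_mul] at hle
    exact absurd h0.pos0 (not_lt.2 hle)
  · have hTP : T = p⁻¹ • P := by rw [hpT, smul_smul, inv_mul_cancel₀ hp.ne', one_smul]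
    have hTpsd : T.PosSemidef := by rw [hTP]; exact hP.smul (inv_nonneg.2 hp.le)
    have hz := (hTpsd.dotProduct_mulVec_zero_iff (v 0)).1 (by simpa using h0.quadratic_self)
    have := h0.pos4
    rw [hz] at this
    exact lt_irrefl _ this

lemma eq_smul_of_add (hT : T.IsSymm) (h : ∀ j, IsCyclicTriple T v j)
    {B C : Matrix (Fin 6) (Fin 6) ℝ} (hB : Copositive B) (hC : Copositive C) (hBC : T = B + C) :
    ∃ b : ℝ, 0 ≤ b ∧ B = b • T := by
  have hzero : ∀ j, IsCopositiveZero B (v j) ∧ IsCopositiveZero C (v j) := by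
    intro j
    have hq := (h j).quadratic_self
    rw [hBC, add_mulVec, dotProduct_add] at hq
    have h1 := hB.2 _ (h j).nonneg
    have h2 := hC.2 _ (h j).nonneg
    exact ⟨⟨(h j).nonneg, (h j).ne_zero, by linarith⟩, (h j).nonneg, (h j).ne_zero, by linarith⟩
  have hBv : ∀ j i, (T *ᵥ v j) i = 0 → (B *ᵥ v j) i = 0 := by
    intro j i hi
    have h1 := (hzero j).1.mulVec_nonneg hB i
    have h2 := (hzero j).2.mulVec_nonneg hC i
    rw [hBC, add_mulVec, Pi.add_apply] at hi
    simp only [Pi.zero_apply] at h1 h2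
    linarith
  have hTv : ∀ j i, j ≠ i + 2 → (T *ᵥ v j) i = 0 := by
    intro j i
    refine forall_fin_six_shift j (p := fun i => j ≠ i + 2 → (T *ᵥ v j) i = 0)
      (fun _ => (h j).ker0) (fun _ => (h j).ker1) (fun _ => (h j).ker2) (fun _ => (h j).ker3)
      (fun hne => absurd ?_ hne) (fun _ => (h j).ker5) i
    rw [fin_six_add_add j 4 2 0 rfl, add_zero]
  -- Row `i` of `T` is orthogonal to every `v j` with `j ≠ i + 2`, and so is row `i` of `B`. By the
  -- field `row` these equations have at most a one-dimensional solution space, normalised here by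
  -- the diagonal entry.
  have hrow : ∀ i k, B i k = B i i * T i k := by
    intro i k
    have hx := (h i).row (fun k => B i k - B i i * T i k) (by simp [(h i).diag]) (fun j hj => ?_)
    · exact sub_eq_zero.1 (congrFun hx k)
    · have h1 := hTv j i hj
      have h2 := hBv j i h1
      change (B i - B i i • T i) ⬝ᵥ v j = 0
      rw [sub_dotProduct, smul_dotProduct]
      change (B *ᵥ v j) i - B i i • (T *ᵥ v j) i = 0
      rw [h1, h2, smul_zero, sub_zero]
  have hdiag : ∀ j, B (j + 1) (j + 1) = B j j := by
    intro j
    -- Since `B i k = B k k * T i k` by symmetry, `T *ᵥ e` vanishes wherever `T *ᵥ v j` does. As `e`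
    -- lives on `j + 1` and `j + 2`, the form vanishes at `e`, and definiteness on this pair gives
    -- `e = 0`.
    set e : Fin 6 → ℝ := fun k => (B k k - B j j) * v j k with he
    have hTe : ∀ i, (T *ᵥ v j) i = 0 → (T *ᵥ e) i = 0 := by
      intro i hi
      have hBi := hBv j i hi
      have e1 : (T *ᵥ e) i = (B *ᵥ v j) i - B j j * (T *ᵥ v j) i := by
        simp only [mulVec, dotProduct, he, Finset.mul_sum, ← Finset.sum_sub_distrib]
        refine Finset.sum_congr rfl fun k _ => ?_
        rw [← hB.1.apply i k, hrow k i, hT.apply i k]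
        ring
      rw [e1, hBi, hi, mul_zero, sub_zero]
    have e0 : e j = 0 := by simp [he]
    have e3 : e (j + 3) = 0 := by simp [he, (h j).zero3]
    have e4 : e (j + 4) = 0 := by simp [he, (h j).zero4]
    have e5 : e (j + 5) = 0 := by simp [he, (h j).zero5]
    have hq : e ⬝ᵥ (T *ᵥ e) = 0 := by
      rw [dotProduct, sum_fin_six_shift j, e0, e3, e4, e5, hTe _ (h j).ker1, hTe _ (h j).ker2]
      ring
    have hz := (h (j + 1)).eq_zero_of_pair (z := e)
      (by rwa [fin_six_add_add j 1 2 3 rfl]) (by rwa [fin_six_add_add j 1 3 4 rfl])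
      (by rwa [fin_six_add_add j 1 4 5 rfl])
      (by rwa [fin_six_add_add j 1 5 0 rfl, add_zero]) hq.le
    have := congrFun hz (j + 1)
    exact sub_eq_zero.1 ((mul_eq_zero.1 this).resolve_right (h j).pos1.ne')
  have hall : ∀ i, B i i = B 0 0 := by
    have d0 := hdiag 0
    have d1 := hdiag 1
    have d2 := hdiag 2
    have d3 := hdiag 3
    have d4 := hdiag 4
    intro i
    fin_cases i
    · rfl
    · exact d0
    · exact d1.trans d0
    · exact d2.trans (d1.trans d0)
    · exact d3.trans (d2.trans (d1.trans d0))
    · exact d4.trans (d3.trans (d2.trans (d1.trans d0)))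
  refine ⟨B 0 0, ?_, ?_⟩
  · simpa using hB.2 (Pi.single 0 1) (Pi.single_nonneg.2 zero_le_one)
  · ext i k
    rw [hrow, hall, Matrix.smul_apply, smul_eq_mul]

lemma isExtremalCopositive (hT : T.IsSymm) (h : ∀ j, IsCyclicTriple T v j) :
    IsExtremalCopositive T := by
  refine ⟨copositive hT h, fun h0 => ?_, fun B C hB hC hBC =>
    ⟨eq_smul_of_add hT h hB hC hBC, eq_smul_of_add hT h hC hB (by rw [hBC, add_comm])⟩⟩
  have := (h 0).diag
  rw [h0] at this
  exact zero_ne_one this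

/-- Expanding `y` in `v j`, `v (j + 1)`, `v (j + 2)` leaves a remainder `r` on `j + 1` and `j + 2`.
The form at `y` is its value at `r` plus a nonnegative multiple of `α * γ`, so `r = 0` and `α * γ =
0`. Then all coefficients are nonnegative, and any positive one gives a support contained in that of
`y`. -/
lemma exists_posSupport_subset_of_apply_eq_zero (hT : T.IsSymm) (h : ∀ j, IsCyclicTriple T v j)
    {y : Fin 6 → ℝ} (hy : IsCopositiveZero T y) {j : Fin 6} (hj : y (j + 5) = 0) :
    ∃ k, posSupport (v k) ⊆ posSupport y := by
  obtain ⟨⟨a1, a2, a3, a4, a5, a0⟩, ⟨k1, k2, k3, k4, -, k0⟩⟩ := succ_facts h j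
  obtain ⟨⟨b2, b3, b4, b5, b0, b1⟩, ⟨l2, l3, l4, l5, l0, l1⟩⟩ := succ_facts h (j + 1)
  have e1 : j + 1 + 1 = j + 2 := fin_six_add_add j 1 1 2 rfl
  have e2 : j + 1 + 2 = j + 3 := fin_six_add_add j 1 2 3 rfl
  have e3 : j + 1 + 3 = j + 4 := fin_six_add_add j 1 3 4 rfl
  have e4 : j + 1 + 4 = j + 5 := fin_six_add_add j 1 4 5 rfl
  have e5 : j + 1 + 5 = j := by rw [fin_six_add_add j 1 5 0 rfl, add_zero]
  simp only [e1, e2, e3, e4, e5] at b2 b3 b4 b5 b0 b1 l2 l3 l4 l5 l0 l1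
  have hj0 := h j
  set α := y j / v j j with hα
  set γ := y (j + 4) / v (j + 2) (j + 4) with hγ
  set β := (y (j + 3) - γ * v (j + 2) (j + 3)) / v (j + 1) (j + 3) with hβ
  have hα0 : 0 ≤ α := div_nonneg (hy.1 _) hj0.pos0.le
  have hγ0 : 0 ≤ γ := div_nonneg (hy.1 _) b4.le
  set r := y - α • v j - β • v (j + 1) - γ • v (j + 2) with hr
  have r0 : r j = 0 := by simp [hr, hα, a0, b0, hj0.pos0.ne']
  have r3 : r (j + 3) = 0 := by simp [hr, hβ, hj0.zero3, a3.ne']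
  have r4 : r (j + 4) = 0 := by simp [hr, hγ, hj0.zero4, a4, b4.ne']
  have r5 : r (j + 5) = 0 := by simp [hr, hj, hj0.zero5, a5, b5]
  have hyr : y = ((r + α • v j) + β • v (j + 1)) + γ • v (j + 2) := by rw [hr]; abel
  have q1 : ∀ x : Fin 6 → ℝ, x (j + 5) = 0 → x ⬝ᵥ (T *ᵥ v (j + 1)) = 0 := by
    intro x hx
    rw [dotProduct, sum_fin_six_shift j, k0, k1, k2, k3, k4, hx]; ring
  have q2 : ∀ x : Fin 6 → ℝ, x ⬝ᵥ (T *ᵥ v (j + 2)) = x j * (T *ᵥ v (j + 2)) j := by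
    intro x
    rw [dotProduct, sum_fin_six_shift j, l1, l2, l3, l4, l5]; ring
  have hq : y ⬝ᵥ (T *ᵥ y) =
      r ⬝ᵥ (T *ᵥ r) + 2 * γ * (α * v j j * (T *ᵥ v (j + 2)) j) := by
    conv_lhs => rw [hyr]
    rw [hT.quadratic_add_smul, hT.quadratic_add_smul, hT.quadratic_add_smul, hj0.quadratic_self,
      (h (j + 1)).quadratic_self, (h (j + 2)).quadratic_self, hj0.dotProduct_mulVec, r4,
      q1 _ (by simp [r5, hj0.zero5]), q2]
    simp only [Pi.add_apply, Pi.smul_apply, r0, a0, smul_eq_mul]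
    ring
  rw [hy.2.2] at hq
  have hr0 : 0 ≤ r ⬝ᵥ (T *ᵥ r) := hj0.quadratic_nonneg_of_triple hT r3 r4 r5
  have hp : 0 ≤ γ * (α * v j j * (T *ᵥ v (j + 2)) j) :=
    mul_nonneg hγ0 (mul_nonneg (mul_nonneg hα0 hj0.pos0.le) l0.le)
  have hrz : r = 0 := (h (j + 1)).eq_zero_of_pair (by rwa [e2]) (by rwa [e3]) (by rwa [e4])
    (by rwa [e5]) (by linarith)
  have hαγ : γ = 0 ∨ α = 0 := by
    have : γ * (α * v j j * (T *ᵥ v (j + 2)) j) = 0 := by linarith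
    rcases mul_eq_zero.1 this with h1 | h1
    · exact Or.inl h1
    · exact Or.inr ((mul_eq_zero.1 ((mul_eq_zero.1 h1).resolve_right l0.ne')).resolve_right
        hj0.pos0.ne')
  rw [hrz, zero_add] at hyr
  have hβ0 : 0 ≤ β := by
    rcases hαγ with h0 | h0
    · rw [hβ, h0, zero_mul, sub_zero]
      exact div_nonneg (hy.1 _) a3.le
    · have e := congrFun hyr (j + 1)
      simp only [Pi.add_apply, Pi.smul_apply, h0, b1, smul_eq_mul] at e
      have h1 : 0 ≤ β * v (j + 1) (j + 1) := by
        have : 0 ≤ y (j + 1) := hy.1 _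
        linarith
      exact nonneg_of_mul_nonneg_left h1 a1
  have hn0 := hj0.nonneg
  have hn1 := (h (j + 1)).nonneg
  have hn2 := (h (j + 2)).nonneg
  have hyi : ∀ i, y i = α * v j i + β * v (j + 1) i + γ * v (j + 2) i := fun i => congrFun hyr i
  have t0 : ∀ i, 0 ≤ α * v j i := fun i => mul_nonneg hα0 (hn0 i)
  have t1 : ∀ i, 0 ≤ β * v (j + 1) i := fun i => mul_nonneg hβ0 (hn1 i)
  have t2 : ∀ i, 0 ≤ γ * v (j + 2) i := fun i => mul_nonneg hγ0 (hn2 i)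
  rcases hα0.eq_or_lt with ha | ha
  · rcases hβ0.eq_or_lt with hb | hb
    · rcases hγ0.eq_or_lt with hc | hc
      · exfalso
        apply hy.2.1
        ext i
        rw [hyi, ← ha, ← hb, ← hc]; simp
      · refine ⟨j + 2, fun i (hi : 0 < v (j + 2) i) => ?_⟩
        change 0 < y i
        rw [hyi]
        linarith [t0 i, t1 i, mul_pos hc hi]
    · refine ⟨j + 1, fun i (hi : 0 < v (j + 1) i) => ?_⟩
      change 0 < y i
      rw [hyi]
      linarith [t0 i, t2 i, mul_pos hb hi]
  · refine ⟨j, fun i (hi : 0 < v j i) => ?_⟩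
    change 0 < y i
    rw [hyi]
    linarith [t1 i, t2 i, mul_pos ha hi]

lemma exists_posSupport_subset (hT : T.IsSymm) (h : ∀ j, IsCyclicTriple T v j)
    {y : Fin 6 → ℝ} (hy : IsCopositiveZero T y) : ∃ k, posSupport (v k) ⊆ posSupport y := by
  by_cases hz : ∃ i, y i = 0
  · obtain ⟨i, hi⟩ := hz
    refine exists_posSupport_subset_of_apply_eq_zero hT h hy (j := i + 1) ?_
    rwa [fin_six_add_add i 1 5 0 rfl, add_zero]
  · push Not at hz
    -- A zero without vanishing entries has full support, so any index serves.
    exact ⟨0, fun i _ => (hy.1 i).lt_of_ne' (hz i)⟩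

lemma not_posSupport_ssubset (h : ∀ j, IsCyclicTriple T v j) (k l : Fin 6) :
    ¬ posSupport (v k) ⊂ posSupport (v l) := by
  intro hkl
  have h1 : ∀ i : Fin 6, (i = k ∨ i = k + 1 ∨ i = k + 2) → (i = l ∨ i = l + 1 ∨ i = l + 2) :=
    fun i hi => ((h l).mem_posSupport_iff i).1 (hkl.1 (((h k).mem_posSupport_iff i).2 hi))
  have hkl' : k = l := by
    clear hkl h
    revert k l
    decide
  rw [hkl'] at hkl
  exact hkl.2 subset_rfl

lemma isMinimalZero_iff (hT : T.IsSymm) (h : ∀ j, IsCyclicTriple T v j) (w : Fin 6 → ℝ) :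
    IsMinimalZero T w ↔ ∃ (j : Fin 6) (c : ℝ), 0 < c ∧ w = c • v j := by
  constructor
  · rintro ⟨hw, hmin⟩
    obtain ⟨j, hj⟩ := exists_posSupport_subset hT h hw
    have heq : posSupport w ⊆ posSupport (v j) := by
      by_contra hne
      exact hmin _ (h j).isCopositiveZero ⟨hj, hne⟩
    have hz : ∀ i, v j i = 0 → w i = 0 := by
      intro i hi
      by_contra hne
      have : 0 < v j i := heq ((hw.1 i).lt_of_ne' hne)
      exact this.ne' hi
    have hw0 : 0 < w j := hj ((h j).pos0 : j ∈ posSupport (v j))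
    refine ⟨j, w j / v j j, div_pos hw0 (h j).pos0, ?_⟩
    set c := w j / v j j with hc
    have hx : w = (w - c • v j) + c • v j := by abel
    have e2 : j + 1 + 2 = j + 3 := fin_six_add_add j 1 2 3 rfl
    have e3 : j + 1 + 3 = j + 4 := fin_six_add_add j 1 3 4 rfl
    have e4 : j + 1 + 4 = j + 5 := fin_six_add_add j 1 4 5 rfl
    have e5 : j + 1 + 5 = j := by rw [fin_six_add_add j 1 5 0 rfl, add_zero]
    have r0 : (w - c • v j) j = 0 := by simp [hc, (h j).pos0.ne']
    have r3 : (w - c • v j) (j + 3) = 0 := by simp [(h j).zero3, hz _ (h j).zero3]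
    have r4 : (w - c • v j) (j + 4) = 0 := by simp [(h j).zero4, hz _ (h j).zero4]
    have r5 : (w - c • v j) (j + 5) = 0 := by simp [(h j).zero5, hz _ (h j).zero5]
    have hq := hT.quadratic_add_smul (w - c • v j) (v j) c
    rw [← hx, (h j).quadratic_self, (h j).dotProduct_mulVec, r4, hw.2.2] at hq
    -- Once the entry `j` is cleared, the difference lives on the pair `j + 1`, `j + 2`, where the
    -- form is definite; zeros with the same support are therefore proportional.
    have hr := (h (j + 1)).eq_zero_of_pair (z := w - c • v j) (by rwa [e2]) (by rwa [e3])
      (by rwa [e4]) (by rwa [e5]) (by linarith)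
    exact sub_eq_zero.1 hr
  · rintro ⟨j, c, hc, rfl⟩
    have hs : posSupport (c • v j) = posSupport (v j) := by
      ext i
      simp [posSupport, mul_pos_iff_of_pos_left hc]
    refine ⟨⟨smul_nonneg hc.le (h j).nonneg, smul_ne_zero hc.ne' (h j).ne_zero, ?_⟩, ?_⟩
    · rw [mulVec_smul, smul_dotProduct, dotProduct_smul, (h j).quadratic_self, smul_zero, smul_zero]
    · intro y hy hss
      obtain ⟨k, hk⟩ := exists_posSupport_subset hT h hy
      rw [hs] at hss
      exact not_posSupport_ssubset h k j (lt_of_le_of_lt hk hss)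

lemma minimalZeroSupportSet_eq (hT : T.IsSymm) (h : ∀ j, IsCyclicTriple T v j) :
    minimalZeroSupportSet T =
      {{0, 1, 2}, {1, 2, 3}, {2, 3, 4}, {3, 4, 5}, {0, 4, 5}, {0, 1, 5}} := by
  have hsupp : ∀ (j : Fin 6) (S : Set (Fin 6)),
      (∀ i, i ∈ S ↔ i = j ∨ i = j + 1 ∨ i = j + 2) → posSupport (v j) = S :=
    fun j S hS => Set.ext fun i => ((h j).mem_posSupport_iff i).trans (hS i).symm
  have s0 := hsupp 0 {0, 1, 2} (by simp only [Set.mem_insert_iff, Set.mem_singleton_iff]; decide)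
  have s1 := hsupp 1 {1, 2, 3} (by simp only [Set.mem_insert_iff, Set.mem_singleton_iff]; decide)
  have s2 := hsupp 2 {2, 3, 4} (by simp only [Set.mem_insert_iff, Set.mem_singleton_iff]; decide)
  have s3 := hsupp 3 {3, 4, 5} (by simp only [Set.mem_insert_iff, Set.mem_singleton_iff]; decide)
  have s4 := hsupp 4 {0, 4, 5} (by simp only [Set.mem_insert_iff, Set.mem_singleton_iff]; decide)
  have s5 := hsupp 5 {0, 1, 5} (by simp only [Set.mem_insert_iff, Set.mem_singleton_iff]; decide)
  have hS : ∀ S, S ∈ minimalZeroSupportSet T ↔ ∃ j, S = posSupport (v j) := by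
    intro S
    constructor
    · rintro ⟨w, hw, rfl⟩
      obtain ⟨j, c, hc, rfl⟩ := (isMinimalZero_iff hT h w).1 hw
      refine ⟨j, ?_⟩
      ext i
      simp [posSupport, mul_pos_iff_of_pos_left hc]
    · rintro ⟨j, rfl⟩
      exact ⟨v j, (isMinimalZero_iff hT h _).2 ⟨j, 1, one_pos, (one_smul _ _).symm⟩, rfl⟩
  ext S
  rw [hS, ← s0, ← s1, ← s2, ← s3, ← s4, ← s5]
  simp only [Set.mem_insert_iff, Set.mem_singleton_iff]
  constructor
  · rintro ⟨j, rfl⟩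
    fin_cases j <;> simp
  · rintro (rfl | rfl | rfl | rfl | rfl | rfl) <;> exact ⟨_, rfl⟩

end IsCyclicTriple

theorem mainTheorem12 :
    (∀ A : Matrix (Fin 6) (Fin 6) ℝ, IsExceptional A → IsExtremalCopositive A →
      (∀ j : Fin 6, ∃ u : Fin 6 → ℝ, IsCopositiveZero A u ∧ posSupport u = cyclicFour j) →
        (∃ φ₁ φ₂ φ₃ : ℝ, 0 < φ₁ ∧ 0 < φ₂ ∧ 0 < φ₃ ∧ φ₁ + φ₂ + φ₃ < Real.pi ∧
          A ∈ MulAction.orbit (copositiveGroup 6) (trigMatrix φ₁ φ₂ φ₃)) ∧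
        minimalZeroSupportSet A =
          {{0, 1, 2}, {1, 2, 3}, {2, 3, 4}, {3, 4, 5}, {0, 4, 5}, {0, 1, 5}}) ∧
    (∀ φ₁ φ₂ φ₃ : ℝ, 0 < φ₁ → 0 < φ₂ → 0 < φ₃ → φ₁ + φ₂ + φ₃ < Real.pi →
      IsExceptional (trigMatrix φ₁ φ₂ φ₃) ∧
      IsExtremalCopositive (trigMatrix φ₁ φ₂ φ₃) ∧
      ∀ v : Fin 6 → ℝ, IsMinimalZero (trigMatrix φ₁ φ₂ φ₃) v ↔
        ∃ (j : Fin 6) (c : ℝ), 0 < c ∧ v = c • (trigZeroMatrix φ₁ φ₂ φ₃).col j) := by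
  refine ⟨fun A hexc hext hz => ?_, fun a b c ha hb hc h => ?_⟩
  · choose u hu hs using hz
    have hA := hexc.1
    have hcyc := CyclicZeros.of_zeros hA hu hs
    have hpsd : ∀ x : Fin 6 → ℝ, x 3 = 0 → x 4 = 0 → x 5 = 0 → 0 ≤ x ⬝ᵥ (A *ᵥ x) := by
      intro x h3 h4 h5
      refine (hu 0).quadratic_nonneg hA fun i hi => ?_
      have p0 := hcyc.pos0 0
      have p1 := hcyc.pos1 0
      have p2 := hcyc.pos2 0
      fin_cases i
      · exact absurd hi p0.ne'
      · exact absurd hi p1.ne'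
      · exact absurd hi p2.ne'
      · exact h3
      · exact h4
      · exact h5
    have hdiag := hcyc.diag_pos hpsd hexc
    -- Scaling by the inverse square roots of the diagonal entries normalises the diagonal to 1, as
    -- the planar representation requires.
    set d : Fin 6 → ℝ := fun i => √(A i i) with hd
    have hd0 : ∀ i, 0 < d i := fun i => Real.sqrt_pos.2 (hdiag i)
    have hd0' : ∀ i, 0 < d⁻¹ i := fun i => by simpa using hd0 i
    have hone : ∀ i, diagScale d⁻¹ A i i = 1 := by
      intro i
      have h1 : d i * d i = A i i := Real.mul_self_sqrt (hdiag i).le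
      have := (hd0 i).ne'
      rw [diagScale_apply, Pi.inv_apply, ← h1]
      field_simp
    obtain ⟨a, b, c, ha, hb, hc, h, hT⟩ := (hcyc.diagScale hd0').exists_eq_trigMatrix
      (fun x h3 h4 h5 => by
        rw [diagScale_quadratic]
        exact hpsd _ (by simp [h3]) (by simp [h4]) (by simp [h5]))
      (hexc.diagScale hd0') (hext.diagScale hd0') hone
    have hAT : A = diagScale d (trigMatrix a b c) := by rw [← hT, diagScale_inv' d hd0]
    refine ⟨⟨a, b, c, ha, hb, hc, h, ?_⟩, ?_⟩
    · rw [hAT]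
      exact diagScale_mem_orbit hd0 _
    · rw [hAT, minimalZeroSupportSet_diagScale hd0]
      exact IsCyclicTriple.minimalZeroSupportSet_eq (trigMatrix_isSymm a b c)
        (isCyclicTriple_trigMatrix ha hb hc h)
  · have hT := trigMatrix_isSymm a b c
    have ht := isCyclicTriple_trigMatrix ha hb hc h
    have hext := IsCyclicTriple.isExtremalCopositive hT ht
    exact ⟨IsCyclicTriple.isExceptional hT ht hext, hext, IsCyclicTriple.isMinimalZero_iff hT ht⟩
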